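/- Let $N\cong\mathbb Z^n$ be a lattice, $M=\operatorname{Hom}(N,\mathbb Z)$, and work over an algebraically closed field of characteristic zero. Let $P\subset N_{\mathbb R}$ be a reflexive polytope, that is, a lattice polytope with the origin in its interior such that $P^\circ=\{u\in M_{\mathbb R}:\langle u,x\rangle\ge -1\ \text{for all }x\in P\}$ is a lattice polytope with respect to $M$. Let $\Sigma$ be a unimodular rational fan in $M_{\mathbb R}$, whose minimal cone is allowed to be a non-zero linear subspace, and suppose that $P^\circ$ is cracked along $\Sigma$: for every maximal cone $B$ of $\Sigma$, every tangent cone of the polytope $P^\circ\cap B$ is unimodular. Let $\bar\Sigma$ be the quotient of $\Sigma$ by its minimal cone, and assume that the toric variety $Z=\mathrm{TV}(\bar\Sigma)$ is smooth and projective. Then $P$ has facets of Cayley type with respect to $\Sigma$. That is, let $F$ be a facet of $P$. Then the dual face $F^\star=\{u\in P^\circ:\langle u,x\rangle=-1\ \text{for all }x\in F\}$ is a single point $v$, and there is a smallest cone $C$ of $\Sigma$ containing $v$. Put $r=\dim C$, and let $Z_C$ be the torus-invariant stratum of $Z$ that corresponds to $C$, i.e. the toric variety of the fan formed by the images in $M_{\mathbb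 R}/\langle C\rangle$ of the cones of $\Sigma$ containing $C$; its character lattice is $\operatorname{Ann}\langle C\rangle\subset N$. There are torus-invariant nef divisors $D_1,\dots,D_r$ on $Z_C$, with polyhedra of sections $P_{D_j}\subset(\operatorname{Ann}\langle C\rangle)_{\mathbb R}$, and an affine isomorphism $$\varphi\colon N_{\mathbb R}\to(\operatorname{Ann}\langle C\rangle)_{\mathbb R}\oplus\mathbb R^r,\qquad \varphi(N)=\operatorname{Ann}\langle C\rangle\oplus\mathbb Z^r,$$ whose linear part restricts to the identity $\operatorname{Ann}\langle C\rangle\to\operatorname{Ann}\langle C\rangle\oplus 0$, such that $\varphi(F)$ is the Cayley sum $$P_{D_1}\star\cdots\star P_{D_r}=\operatorname{conv}\Big(\bigcup_{j=1}^r\,(P_{D_j}+e_j)\Big).$$ -/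

import Mathlib

open CategoryTheory AlgebraicGeometry Module

universe u

namespace CayleyFacets

/-! ### Lattices, cones and polytopes -/

section Lattice

variable {E : Type} [AddCommGroup E] [Module ℝ E]

/-- The dual lattice `Hom(Λ, ℤ)`: the linear forms that are integral on `Λ`. -/
def dualLattice (Λ : AddSubgroup E) : AddSubgroup (Dual ℝ E) where
  carrier := {f | ∀ x ∈ Λ, ∃ z : ℤ, f x = z}
  zero_mem' := fun _ _ => ⟨0, by simp⟩
  add_mem' := by
    intro f g hf hg x hx
    obtain ⟨a, ha⟩ := hf x hx
    obtain ⟨b, hb⟩ := hg x hx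
    exact ⟨a + b, by simp [ha, hb]⟩
  neg_mem' := by
    intro f hf x hx
    obtain ⟨a, ha⟩ := hf x hx
    exact ⟨-a, by simp [ha]⟩

/-- The image of the lattice `Λ ⊆ E` in the quotient space `E ⧸ W`, that is `Λ ⧸ (Λ ∩ W)`. -/
def quotLattice (Λ : AddSubgroup E) (W : Submodule ℝ E) : AddSubgroup (E ⧸ W) :=
  Λ.map W.mkQ.toAddMonoidHom

/-- A convex polytope whose vertices are lattice points. -/
def IsLatticePolytope (Λ : AddSubgroup E) (Q : Set E) : Prop :=
  ∃ s : Finset E, (s : Set E) ⊆ Λ ∧ Q = convexHull ℝ (s : Set E)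

/-- A rational polyhedral cone (possibly containing lines). -/
def IsRationalCone (Λ : AddSubgroup E) (σ : PointedCone ℝ E) : Prop :=
  ∃ s : Finset E, (s : Set E) ⊆ Λ ∧ σ = PointedCone.hull ℝ (s : Set E)

/-- A unimodular cone: there is a `ℤ`-basis `b` of the lattice such that the cone is the sum of the
linear space spanned by the `b i`, `i ∈ I` (its lineality space), and of the cone spanned by the
`b j`, `j ∈ J`. For a strongly convex cone (`I = ∅`) this says that the cone is generated by part
of a basis of the lattice; in general it says this of the image of the cone in the quotient by its
lineality space. -/
def IsUnimodularCone (Λ : AddSubgroup E) (σ : PointedCone ℝ E) : Prop :=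
  ∃ (b : Basis (Fin (finrank ℤ Λ)) ℤ Λ) (I J : Set (Fin (finrank ℤ Λ))), Disjoint I J ∧
    σ = PointedCone.hull ℝ
      ((fun i => (b i : E)) '' I ∪ (fun i => -(b i : E)) '' I ∪ (fun j => (b j : E)) '' J)

/-- The tangent cone of the polyhedron `Q` at `x`, translated so that its apex is the origin. -/
def tangentCone (Q : Set E) (x : E) : PointedCone ℝ E :=
  PointedCone.hull ℝ ((fun y => y - x) '' Q)

/-! ### Fans -/

/-- A (generalized) rational fan: a finite non-empty set of rational polyhedral cones, closed under
passing to faces, any two of which meet in a common face. The minimal cone need not be `0`. -/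
structure IsFan (Λ : AddSubgroup E) (Δ : Set (PointedCone ℝ E)) : Prop where
  finite : Δ.Finite
  nonempty : Δ.Nonempty
  rational : ∀ σ ∈ Δ, IsRationalCone Λ σ
  face_mem : ∀ σ ∈ Δ, ∀ τ : PointedCone ℝ E, τ.IsFaceOf σ → τ ∈ Δ
  inter_face : ∀ σ ∈ Δ, ∀ τ ∈ Δ, (σ ⊓ τ).IsFaceOf σ

/-- A fan all of whose cones are unimodular. -/
structure IsUnimodularFan (Λ : AddSubgroup E) (Δ : Set (PointedCone ℝ E)) : Prop
    extends IsFan Λ Δ where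
  unimodular : ∀ σ ∈ Δ, IsUnimodularCone Λ σ

/-- The linear span `⟨C⟩` of a cone. -/
def coneSpan (C : PointedCone ℝ E) : Submodule ℝ E := Submodule.span ℝ (C : Set E)

/-- The minimal cone of a fan: the intersection of all its cones. -/
def minCone (Δ : Set (PointedCone ℝ E)) : PointedCone ℝ E := sInf Δ

/-- The star of the cone `C`: the fan in `E ⧸ ⟨C⟩` formed by the images of the cones that
contain `C`. For `C` the minimal cone this is the quotient of the fan by its minimal cone. -/
def starFan (Δ : Set (PointedCone ℝ E)) (C : PointedCone ℝ E) :
    Set (PointedCone ℝ (E ⧸ coneSpan C)) :=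
  {τ | ∃ σ ∈ Δ, C ≤ σ ∧ τ = σ.map (coneSpan C).mkQ}

/-- The primitive generators of the rays of a fan of strongly convex cones. -/
def rayGenerators (Λ : AddSubgroup E) (Δ : Set (PointedCone ℝ E)) : Set E :=
  {u | u ∈ Λ ∧ u ≠ 0 ∧ PointedCone.hull ℝ {u} ∈ Δ ∧
    ∀ w ∈ Λ, w ∈ PointedCone.hull ℝ {u} → ∃ m : ℕ, w = m • u}

/-- The polyhedron `Q` is cracked along the fan `Δ`: the fan is unimodular, and for every maximal
cone `C` of `Δ` every tangent cone of `Q ∩ C` is unimodular. -/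
def IsCracked (Λ : AddSubgroup E) (Q : Set E) (Δ : Set (PointedCone ℝ E)) : Prop :=
  IsUnimodularFan Λ Δ ∧
    ∀ C : PointedCone ℝ E, Maximal (fun σ => σ ∈ Δ) C →
      ∀ x ∈ Q ∩ (C : Set E), IsUnimodularCone Λ (tangentCone (Q ∩ (C : Set E)) x)

end Lattice

/-! ### Toric varieties -/

section Toric

variable {E : Type} [AddCommGroup E] [Module ℝ E]

/-- The monoid `σ^∨ ∩ Hom(Λ, ℤ)` of the characters that are regular on the affine toric variety
of `σ`. -/
def charMonoid (Λ : AddSubgroup E) (σ : PointedCone ℝ E) : AddSubmonoid (Dual ℝ E) where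
  carrier := {m | m ∈ dualLattice Λ ∧ ∀ x ∈ σ, 0 ≤ m x}
  zero_mem' := ⟨zero_mem _, fun _ _ => by simp⟩
  add_mem' := fun ha hb => ⟨add_mem ha.1 hb.1, fun x hx => add_nonneg (ha.2 x hx) (hb.2 x hx)⟩

theorem charMonoid_anti (Λ : AddSubgroup E) {τ σ : PointedCone ℝ E} (h : τ ≤ σ) :
    charMonoid Λ σ ≤ charMonoid Λ τ := fun _ hm => ⟨hm.1, fun x hx => hm.2 x (h hx)⟩

variable (k : Type u) [Field k]

/-- The semigroup algebra `k[σ^∨ ∩ Hom(Λ, ℤ)]`. -/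
abbrev coordRing (Λ : AddSubgroup E) (σ : PointedCone ℝ E) : Type u :=
  AddMonoidAlgebra k (charMonoid Λ σ)

/-- The affine toric variety `U_σ = Spec k[σ^∨ ∩ Hom(Λ, ℤ)]`. -/
noncomputable abbrev affineToric (Λ : AddSubgroup E) (σ : PointedCone ℝ E) : Scheme.{u} :=
  Spec (CommRingCat.of (coordRing k Λ σ))

/-- The structure morphism `U_σ ⟶ Spec k`. -/
noncomputable def affineToricStr (Λ : AddSubgroup E) (σ : PointedCone ℝ E) :
    affineToric k Λ σ ⟶ Spec (CommRingCat.of k) :=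
  Spec.map (CommRingCat.ofHom (algebraMap k (coordRing k Λ σ)))

/-- The morphism `U_τ ⟶ U_σ` for `τ ≤ σ`, given by the inclusion of the character monoids. -/
noncomputable def affineToricMap (Λ : AddSubgroup E) {τ σ : PointedCone ℝ E} (h : τ ≤ σ) :
    affineToric k Λ τ ⟶ affineToric k Λ σ :=
  Spec.map (CommRingCat.ofHom (AddMonoidAlgebra.mapDomainRingHom k
    (AddSubmonoid.inclusion (charMonoid_anti Λ h))))

/-- The toric variety `TV(Δ)` over `k` of a fan `Δ` of strongly convex cones with respect to the
lattice `Λ`: the scheme glued from the affine toric varieties `U_σ`, `σ ∈ Δ`, where `U_σ` and `U_τ`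
are glued along their common open subscheme `U_ρ`, `ρ = σ ∩ τ`. The data below determine the scheme
up to a unique isomorphism. -/
structure ToricVariety (Λ : AddSubgroup E) (Δ : Set (PointedCone ℝ E)) where
  X : Scheme.{u}
  str : X ⟶ Spec (CommRingCat.of k)
  chart : ∀ σ : Δ, affineToric k Λ σ.1 ⟶ X
  isOpenImmersion : ∀ σ : Δ, IsOpenImmersion (chart σ)
  chart_str : ∀ σ : Δ, chart σ ≫ str = affineToricStr k Λ σ.1
  chart_face : ∀ (τ σ : Δ) (h : τ.1 ≤ σ.1), affineToricMap k Λ h ≫ chart σ = chart τ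
  cover : ∀ x : X, ∃ σ : Δ, x ∈ Set.range (chart σ)
  inter : ∀ (σ τ : Δ) (x : X), x ∈ Set.range (chart σ) → x ∈ Set.range (chart τ) →
    ∃ ρ : Δ, ρ.1 = σ.1 ⊓ τ.1 ∧ x ∈ Set.range (chart ρ)

attribute [local instance] MvPolynomial.gradedAlgebra

/-- Projective `n`-space over `k`. -/
noncomputable abbrev projSpace (n : ℕ) : Scheme.{u} :=
  Proj (MvPolynomial.homogeneousSubmodule (Fin (n + 1)) k)

/-- The structure morphism of projective space. -/
noncomputable def projSpaceStr (n : ℕ) : projSpace k n ⟶ Spec (CommRingCat.of k) :=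
  Proj.toSpecZero (MvPolynomial.homogeneousSubmodule (Fin (n + 1)) k) ≫
    Spec.map (CommRingCat.ofHom
      (algebraMap k (MvPolynomial.homogeneousSubmodule (Fin (n + 1)) k 0)))

/-- A `k`-scheme is projective if it is a closed subscheme of some projective space over `k`. -/
def IsProjective {X : Scheme.{u}} (f : X ⟶ Spec (CommRingCat.of k)) : Prop :=
  ∃ (n : ℕ) (i : X ⟶ projSpace k n), IsClosedImmersion i ∧ i ≫ projSpaceStr k n = f

/-! ### Divisors on toric varieties -/

/-- A torus-invariant divisor `D = ∑_ρ a_ρ D_ρ`, given by its coefficients; the torus-invariant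
prime divisors `D_ρ` are indexed by the primitive generators of the rays of the fan. -/
abbrev ToricDivisor (Λ : AddSubgroup E) (Δ : Set (PointedCone ℝ E)) : Type :=
  rayGenerators Λ Δ → ℤ

/-- The polyhedron of sections `P_D = {y | ⟨y, ρ⟩ ≥ -a_ρ for all rays ρ}`, in the real vector space
of the character lattice. -/
def sectionPolyhedron {Λ : AddSubgroup E} {Δ : Set (PointedCone ℝ E)} (D : ToricDivisor Λ Δ) :
    Set (Dual ℝ E) :=
  {y | ∀ ρ : rayGenerators Λ Δ, -(D ρ : ℝ) ≤ y ρ}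

/-- Cartier data of `D`: characters `m_σ` such that `D` is on `U_σ` the divisor of the rational
function `χ^(-m_σ)`. -/
def IsCartierData {Λ : AddSubgroup E} {Δ : Set (PointedCone ℝ E)} (D : ToricDivisor Λ Δ)
    (m : Δ → Dual ℝ E) : Prop :=
  ∀ σ : Δ, m σ ∈ dualLattice Λ ∧
    ∀ ρ : rayGenerators Λ Δ, (ρ : E) ∈ σ.1 → m σ ρ = -(D ρ : ℝ)

variable {k} {Λ : AddSubgroup E} {Δ : Set (PointedCone ℝ E)}

/-- `c` is the value of the character `χ^d` at the `R`-valued point `y` of the toric variety: on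
some chart `U_τ` through which `y` factors `χ^d` is regular, and its pull-back is `c`. -/
def ToricVariety.IsCharValue (X : ToricVariety k Λ Δ) {R : CommRingCat.{u}} (y : Spec R ⟶ X.X)
    (d : Dual ℝ E) (c : R) : Prop :=
  ∃ (τ : Δ) (g : Spec R ⟶ affineToric k Λ τ.1) (hd : d ∈ charMonoid Λ τ.1),
    g ≫ X.chart τ = y ∧
      c = (Spec.preimage g).hom
        (AddMonoidAlgebra.single (⟨d, hd⟩ : charMonoid Λ τ.1) (1 : k))

/-- `d` is the degree on the integral curve `i : C ⟶ X` of the line bundle `𝒪(D)`, where `D` has the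
Cartier data `m`. For every point `p` of `C` let `U_(s p)` be a chart that contains its image;
`𝒪(D)` is on this chart the sheaf `χ^(m (s p)) 𝒪`. With `η` the generic point of `C`, the function
`χ^(m (s η))` is a rational section of `𝒪(D)|_C`, and it is the multiple of the local generator at
`p` by the restriction `c p` to `C` of `χ^(m (s η) - m (s p))`. The degree is the sum of the orders
of vanishing of this section at the closed points of `C`. -/
def ToricVariety.HasDegree (X : ToricVariety k Λ Δ) (m : Δ → Dual ℝ E) {C : Scheme.{u}}
    [IsIntegral C] [IsLocallyNoetherian C] (i : C ⟶ X.X) (s : C → Δ) (d : ℤ) : Prop :=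
  ∃ c : C → C.functionField,
    (∀ p : C, X.IsCharValue (C.fromSpecStalk (genericPoint C) ≫ i)
      (m (s (genericPoint C)) - m (s p)) (c p)) ∧
    d = ∑ᶠ p : C, Scheme.ord (c p) p

/-- The divisor `D` on the toric variety is nef: it is Cartier, and `D · C ≥ 0` for every complete
integral closed curve `C`. -/
def ToricVariety.IsNef (X : ToricVariety k Λ Δ) (D : ToricDivisor Λ Δ) : Prop :=
  ∃ m : Δ → Dual ℝ E, IsCartierData D m ∧
    ∀ (C : Scheme.{u}) [IsIntegral C] [IsLocallyNoetherian C] (i : C ⟶ X.X),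
      IsClosedImmersion i → IsProper (i ≫ X.str) → topologicalKrullDim C = 1 →
      ∀ s : C → Δ, (∀ p : C, i p ∈ Set.range (X.chart (s p))) →
        ∃ d : ℤ, X.HasDegree m i s d ∧ 0 ≤ d

end Toric

/-! ### Reflexive polytopes, Cayley sums and facets of Cayley type -/

/-- The Cayley sum of `P_1, …, P_r`: the convex hull of the union of the sets `P_i + e_i`. -/
def cayleySum {W : Type} [AddCommGroup W] [Module ℝ W] {r : ℕ} (P : Fin r → Set W) :
    Set (W × (Fin r → ℝ)) :=
  convexHull ℝ (⋃ i, (fun x => (x, (Pi.single i 1 : Fin r → ℝ))) '' P i)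

section Polytope

variable {V : Type} [NormedAddCommGroup V] [NormedSpace ℝ V]

/-- The polar set `P° = {u | ⟨u, x⟩ ≥ -1 for all x ∈ P}`. -/
def polarSet (P : Set V) : Set (Dual ℝ V) := {u | ∀ x ∈ P, -1 ≤ u x}

/-- A reflexive polytope: a lattice polytope with the origin in its interior whose polar is a
lattice polytope for the dual lattice. -/
def IsReflexive (N : AddSubgroup V) (P : Set V) : Prop :=
  IsLatticePolytope N P ∧ (0 : V) ∈ interior P ∧ IsLatticePolytope (dualLattice N) (polarSet P)

/-- `F` is a facet of the full-dimensional polytope `P`: a non-empty face of codimension one. -/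
def IsFacet (P F : Set V) : Prop :=
  F.Nonempty ∧ IsExposed ℝ P F ∧ finrank ℝ (affineSpan ℝ F).direction + 1 = finrank ℝ V

/-- The face `F^⋆` of `P°` that is dual to the face `F` of `P`. -/
def dualFace (P F : Set V) : Set (Dual ℝ V) := {u ∈ polarSet P | ∀ x ∈ F, u x = -1}

variable (k : Type u) [Field k]

/-- Let `C` be a cone of the fan `Δ` in `M_ℝ`, `M = Hom(N, ℤ)`, and let `Z_C` be the stratum of `C`,
that is the toric variety of the star of `C`; its character lattice is the dual of `M ⧸ (M ∩ ⟨C⟩)`,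
canonically identified with `Ann⟨C⟩ ⊆ N`. The set `F` is of Cayley type for `C` if an affine
isomorphism which respects the lattices, and whose linear part is the canonical identification on
`Ann⟨C⟩`, takes `F` to the Cayley sum of the polyhedra of sections of `dim C` nef divisors on
`Z_C`. -/
def IsCayleyType (N : AddSubgroup V) (Δ : Set (PointedCone ℝ (Dual ℝ V)))
    (C : PointedCone ℝ (Dual ℝ V)) (F : Set V) : Prop :=
  ∃ (φ : V ≃ᵃ[ℝ] Dual ℝ (Dual ℝ V ⧸ coneSpan C) × (Fin (finrank ℝ (coneSpan C)) → ℝ))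
    (D : Fin (finrank ℝ (coneSpan C)) →
      ToricDivisor (quotLattice (dualLattice N) (coneSpan C)) (starFan Δ C)),
    (∀ x : V, x ∈ N ↔
      (φ x).1 ∈ dualLattice (quotLattice (dualLattice N) (coneSpan C)) ∧
        ∀ j, ∃ z : ℤ, (φ x).2 j = z) ∧
    (∀ y : V, (∀ u ∈ C, u y = 0) →
      (∀ u : Dual ℝ V, (φ.linear y).1 ((coneSpan C).mkQ u) = u y) ∧ (φ.linear y).2 = 0) ∧
    (∀ ZC : ToricVariety k (quotLattice (dualLattice N) (coneSpan C)) (starFan Δ C),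
      ∀ j, ZC.IsNef (D j)) ∧
    φ '' F = cayleySum (fun j => sectionPolyhedron (D j))

/-- `P` has facets of Cayley type with respect to the fan `Δ`: for every facet `F` with dual vertex
`v`, and the minimal cone `C` of `Δ` containing `v`, the facet `F` is of Cayley type for `C`. -/
def HasCayleyFacets (N : AddSubgroup V) (P : Set V) (Δ : Set (PointedCone ℝ (Dual ℝ V))) : Prop :=
  ∀ F : Set V, IsFacet P F →
    ∃ (v : Dual ℝ V) (C : PointedCone ℝ (Dual ℝ V)),
      dualFace P F = {v} ∧ IsLeast {σ | σ ∈ Δ ∧ v ∈ σ} C ∧ IsCayleyType k N Δ C F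

end Polytope

end CayleyFacets

/-!
The proof is combinatorial, apart from two facts about toric varieties.

*Completeness.* A projective variety is proper, so by the valuative criterion the one-parameter
subgroup of every lattice vector `u` has a limit in `Z`. A chart `U_σ` that contains the limit has
only characters that are non-negative on `u`, hence `u ∈ σ`
(`ToricVariety.exists_charMonoid_nonneg`). So the cones of `Δ` cover the lattice; being finitely
many closed cones they cover `M_ℝ`, and those of full dimension already do so
(`IsUnimodularFan.exists_mem_full`).

*Nefness.* If the Cartier data of `D` are characters `m_σ` each of which is a global section of
`𝒪(D)`, then for a complete curve meeting `U_σ` the section `χ^(m_σ)` is regular on the curve and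
not identically zero, so that all terms of the sum which defines the degree are non-negative
(`ToricVariety.isNef_of_charMonoid`).

*Combinatorics.* Let `F` be a facet with dual vertex `v`, let `C` be the smallest cone containing
`v`, and let `B ⊇ C` be a full-dimensional cone. The tangent cone of `P° ∩ B` at `v` is defined by
the inequalities `⟨·, x⟩ ≥ 0` for the vertices `x` of `F` and for the inner normals `x` of those
facets of `B` that contain `C`. As it is unimodular, pointed and full-dimensional, its dual is
generated by a basis of `N`, whose members are, by primitivity, among these vectors `x`
(`exists_isStarBasis`). So this basis consists of a basis of `Ann⟨C⟩`, dual to the image of `B` in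
`M_ℝ / ⟨C⟩`, and of `r = dim C` lattice points `x_1^B, …, x_r^B` of `F`, and `F` is contained in
`conv {x_j^B} + (B^∨ ∩ Ann⟨C⟩)`.

Modulo `Ann⟨C⟩` the `x_j^B` are the vertices of the simplex which is the image of `F`; up to
numbering they do not depend on `B` (`IsStarBasis.exists_vertex_eq`). Fix one cone `B₀`. The points
`m_j^B = x_j^B - x_j^{B₀}` lie in `Ann⟨C⟩`, and `m_j^B` is on `B` minimal among all the `m_j^{B'}`;
hence for fixed `j` they are Cartier data of a nef divisor `D_j` on the stratum of `C`
(`IsUnimodularFan.exists_nef_divisor`). The basis of `B₀` splits `N` as `Ann⟨C⟩ ⊕ ℤ^r`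
(`IsStarBasis.exists_splitting`). Every linear form lies, up to a multiple of `v`, in one of the
cones `B`, where its minimum over `F` is attained at some `x_j^B`; therefore a separating hyperplane
shows that `F` is the convex hull of the `x_j^B`, and that its part over the `j`-th unit vector is
the polyhedron of sections of `D_j` (`isCayleyType_of_isStarBasis`).
-/

namespace CayleyFacets

/-! ### Properness, one-parameter subgroups and nef divisors -/

section Toric

variable {E : Type} [AddCommGroup E] [Module ℝ E] (k : Type u) [Field k]

section
attribute [local instance] MvPolynomial.gradedAlgebra

/-- Homogeneous polynomials of degree zero are constants. -/
theorem algebraMap_degreeZero_surjective (n : ℕ) : Function.Surjective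
    (algebraMap k (MvPolynomial.homogeneousSubmodule (Fin (n + 1)) k 0)) := by
  rintro ⟨p, hp⟩
  have hp' : p.totalDegree = 0 := Nat.le_zero.1 (MvPolynomial.IsHomogeneous.totalDegree_le hp)
  refine ⟨p.coeff 0, Subtype.ext ?_⟩
  exact (MvPolynomial.totalDegree_eq_zero_iff_eq_C.1 hp').symm

theorem isProper_projSpaceStr (n : ℕ) : IsProper (projSpaceStr k n) := by
  have : IsScalarTower k (MvPolynomial.homogeneousSubmodule (Fin (n + 1)) k 0)
      (MvPolynomial (Fin (n + 1)) k) := ⟨fun a y z => smul_mul_assoc a y.1 z⟩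
  have : Algebra.FiniteType (MvPolynomial.homogeneousSubmodule (Fin (n + 1)) k 0)
      (MvPolynomial (Fin (n + 1)) k) :=
    Algebra.FiniteType.of_restrictScalars_finiteType k _ _
  have : IsClosedImmersion (Spec.map (CommRingCat.ofHom
      (algebraMap k (MvPolynomial.homogeneousSubmodule (Fin (n + 1)) k 0)))) :=
    IsClosedImmersion.spec_of_surjective _ (algebraMap_degreeZero_surjective k n)
  unfold projSpaceStr
  infer_instance

end

variable {k}

theorem IsProjective.isProper {X : Scheme.{u}} {f : X ⟶ Spec (CommRingCat.of k)}
    (hf : IsProjective k f) : IsProper f := by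
  obtain ⟨n, i, hi, rfl⟩ := hf
  have := isProper_projSpaceStr k n
  infer_instance

/-- A morphism from the spectrum of a local ring factors through every open immersion whose image
contains the image of the closed point. -/
theorem exists_lift_of_closedPoint_mem {U X : Scheme.{u}} (j : U ⟶ X) [IsOpenImmersion j]
    {R : CommRingCat.{u}} [IsLocalRing R] (f : Spec R ⟶ X)
    (h : f (IsLocalRing.closedPoint R) ∈ Set.range j) : ∃ g : Spec R ⟶ U, g ≫ j = f := by
  have h' : f ⁻¹ᵁ j.opensRange = ⊤ := Scheme.preimage_eq_top_of_closedPoint_mem f h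
  refine ⟨IsOpenImmersion.lift j f ?_, IsOpenImmersion.lift_fac ..⟩
  rintro _ ⟨y, rfl⟩
  have : y ∈ f ⁻¹ᵁ j.opensRange := h' ▸ trivial
  exact this

/-- The one-parameter subgroup of a lattice vector `u`, as a `k((t))`-point of the torus: it sends
the character `m` to `t ^ ⟨m, u⟩`. The integer `⟨m, u⟩` is chosen from the integrality of `m`; it is
computed by `oneParameter_single`. -/
noncomputable def oneParameter (Λ : AddSubgroup E) (σ : PointedCone ℝ E) {u : E} (hu : u ∈ Λ) :
    coordRing k Λ σ →+* LaurentSeries k :=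
  AddMonoidAlgebra.liftNCRingHom (HahnSeries.C : k →+* LaurentSeries k)
    { toFun := fun m => HahnSeries.single (m.toAdd.2.1 u hu).choose (1 : k)
      map_one' := by
        have h := (((1 : Multiplicative (charMonoid Λ σ)).toAdd).2.1 u hu).choose_spec
        have : ((((1 : Multiplicative (charMonoid Λ σ)).toAdd).2.1 u hu).choose) = 0 := by
          have h' : (((1 : Multiplicative (charMonoid Λ σ)).toAdd : Dual ℝ E)) u = 0 := rfl
          exact_mod_cast h.symm.trans h'
        rw [this]; rfl
      map_mul' := by
        intro a b
        have ha := (a.toAdd.2.1 u hu).choose_spec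
        have hb := (b.toAdd.2.1 u hu).choose_spec
        have hab := ((a * b).toAdd.2.1 u hu).choose_spec
        have h' : ((a * b).toAdd : Dual ℝ E) u = (a.toAdd : Dual ℝ E) u + (b.toAdd : Dual ℝ E) u :=
          rfl
        have : ((a * b).toAdd.2.1 u hu).choose =
            (a.toAdd.2.1 u hu).choose + (b.toAdd.2.1 u hu).choose := by
          exact_mod_cast hab.symm.trans (h'.trans (congrArg₂ (· + ·) ha hb))
        rw [this, HahnSeries.single_mul_single, one_mul] }
    fun _ _ => Commute.all _ _

theorem oneParameter_single {Λ : AddSubgroup E} {σ : PointedCone ℝ E} {u : E} (hu : u ∈ Λ)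
    (m : charMonoid Λ σ) {z : ℤ} (hz : m.1 u = z) :
    oneParameter (k := k) Λ σ hu (AddMonoidAlgebra.single m 1) = HahnSeries.single z 1 := by
  have : (m.2.1 u hu).choose = z := by
    have := (m.2.1 u hu).choose_spec
    exact_mod_cast this.symm.trans hz
  rw [← this]
  refine (AddMonoidAlgebra.liftNC_single _ _ _ _).trans ?_
  rw [AddMonoidHom.coe_coe, map_one, one_mul]
  rfl

/-- The one-parameter subgroup of `u` has a limit on a proper toric variety, by the valuative
criterion. The characters that are regular on a chart containing the limit are non-negative
on `u`. -/
theorem ToricVariety.exists_charMonoid_nonneg {Λ : AddSubgroup E} {Δ : Set (PointedCone ℝ E)}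
    (Z : ToricVariety k Λ Δ) (hZ : IsProper Z.str) (h0 : ⊥ ∈ Δ) {u : E} (hu : u ∈ Λ) :
    ∃ σ ∈ Δ, ∀ m ∈ charMonoid Λ σ, 0 ≤ m u := by
  let i₁ : Spec (.of (LaurentSeries k)) ⟶ Z.X :=
    Spec.map (CommRingCat.ofHom (oneParameter Λ ⊥ hu)) ≫ Z.chart ⟨⊥, h0⟩
  let i₂ : Spec (.of (PowerSeries k)) ⟶ Spec (.of k) :=
    Spec.map (CommRingCat.ofHom (algebraMap k (PowerSeries k)))
  have hsq : i₁ ≫ Z.str =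
      Spec.map (CommRingCat.ofHom (algebraMap (PowerSeries k) (LaurentSeries k))) ≫ i₂ := by
    rw [Category.assoc, Z.chart_str, affineToricStr, ← Spec.map_comp, ← Spec.map_comp,
      ← CommRingCat.ofHom_comp, ← CommRingCat.ofHom_comp]
    congr 2
    refine RingHom.ext fun x => ?_
    have h1 : oneParameter (k := k) Λ ⊥ hu (algebraMap k (coordRing k Λ ⊥) x) =
        HahnSeries.C x := by
      refine (AddMonoidAlgebra.liftNC_single _ _ _ _).trans ?_
      exact (congrArg (_ * ·) (map_one _)).trans (mul_one _)
    exact h1.trans (HahnSeries.ofPowerSeries_C x).symm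
  have hex : ValuativeCriterion.Existence Z.str := by
    have := UniversallyClosed.eq_valuativeCriterion
    have h2 : UniversallyClosed Z.str := inferInstance
    rw [this] at h2
    exact h2.1
  let S : ValuativeCommSq Z.str :=
    { R := PowerSeries k, K := LaurentSeries k, i₁ := i₁, i₂ := i₂, commSq := ⟨hsq⟩ }
  obtain ⟨l, hl₁, -⟩ : ∃ l : Spec (.of (PowerSeries k)) ⟶ Z.X,
      Spec.map (CommRingCat.ofHom (algebraMap (PowerSeries k) (LaurentSeries k))) ≫ l = i₁ ∧
        l ≫ Z.str = i₂ := by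
    obtain ⟨l, h, h'⟩ := (hex S).exists_lift
    exact ⟨l, h, h'⟩
  have : IsLocalRing (CommRingCat.of (PowerSeries k)) :=
    inferInstanceAs (IsLocalRing (PowerSeries k))
  obtain ⟨σ, hσ⟩ := Z.cover (l (IsLocalRing.closedPoint (PowerSeries k)))
  have := Z.isOpenImmersion σ
  obtain ⟨g, rfl⟩ := exists_lift_of_closedPoint_mem (Z.chart σ) l hσ
  refine ⟨σ, σ.2, fun m hm => ?_⟩
  have hle : (⊥ : PointedCone ℝ E) ≤ σ.1 := bot_le
  have hg : Spec.map (CommRingCat.ofHom (algebraMap (PowerSeries k) (LaurentSeries k))) ≫ g =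
      Spec.map (CommRingCat.ofHom (oneParameter Λ ⊥ hu)) ≫ affineToricMap k Λ hle := by
    rw [← cancel_mono (Z.chart σ), Category.assoc, Category.assoc, Z.chart_face ⟨⊥, h0⟩ σ hle]
    exact hl₁
  have hg' : Spec.preimage g ≫ CommRingCat.ofHom (algebraMap (PowerSeries k) (LaurentSeries k)) =
      CommRingCat.ofHom (AddMonoidAlgebra.mapDomainRingHom k
        (AddSubmonoid.inclusion (charMonoid_anti Λ hle))) ≫
        CommRingCat.ofHom (oneParameter Λ ⊥ hu) := by
    apply Spec.map_injective
    rw [Spec.map_comp, Spec.map_comp, Spec.map_preimage]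
    exact hg
  obtain ⟨z, hz⟩ := hm.1 u hu
  have h1 := congrArg
    (fun f => f.hom (AddMonoidAlgebra.single (⟨m, hm⟩ : charMonoid Λ σ.1) (1 : k)))
    hg'
  simp only [CommRingCat.hom_comp, CommRingCat.hom_ofHom, RingHom.comp_apply,
    AddMonoidAlgebra.mapDomainRingHom_apply, AddMonoidAlgebra.mapDomain_single] at h1
  rw [oneParameter_single hu _ (z := z) hz] at h1
  rw [hz]
  by_contra! hneg
  have hz0 : z < 0 := by exact_mod_cast hneg
  have h2 := congrArg (fun f => HahnSeries.coeff f z) h1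
  simp only [HahnSeries.coeff_single_same] at h2
  generalize (Spec.preimage g).hom _ = f at h2
  have h3 := PowerSeries.coeff_coe f z
  rw [if_pos hz0] at h3
  exact zero_ne_one (h3.symm.trans h2)

/-- A divisor with Cartier data given by characters each of which is a global section is nef: on a
curve, the section given by the character of a chart that meets the curve is regular, and it is not
identically zero. -/
theorem ToricVariety.isNef_of_charMonoid {Λ : AddSubgroup E} {Δ : Set (PointedCone ℝ E)}
    (X : ToricVariety k Λ Δ) (D : ToricDivisor Λ Δ) (m : Δ → Dual ℝ E) (hm : IsCartierData D m)
    (hpos : ∀ σ τ : Δ, m σ - m τ ∈ charMonoid Λ τ.1) : X.IsNef D := by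
  refine ⟨m, hm, ?_⟩
  intro C _ _ i hi hC hdim s hs
  have key : ∀ p : C, ∃ a : C.presheaf.stalk p,
      X.IsCharValue (C.fromSpecStalk (genericPoint C) ≫ i) (m (s (genericPoint C)) - m (s p))
        (algebraMap (C.presheaf.stalk p) C.functionField a) := by
    intro p
    have := X.isOpenImmersion (s p)
    obtain ⟨g, hg⟩ := exists_lift_of_closedPoint_mem (X.chart (s p)) (C.fromSpecStalk p ≫ i) (by
      have h : (C.fromSpecStalk p ≫ i) (IsLocalRing.closedPoint (C.presheaf.stalk p)) = i p :=
        congrArg i (Scheme.fromSpecStalk_closedPoint (x := p))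
      rw [h]; exact hs p)
    have hsp : genericPoint C ⤳ p := genericPoint_specializes p
    refine ⟨(Spec.preimage g).hom (AddMonoidAlgebra.single
      (⟨_, hpos (s (genericPoint C)) (s p)⟩ : charMonoid Λ (s p).1) (1 : k)),
      s p, Spec.map (C.presheaf.stalkSpecializes hsp) ≫ g, hpos _ _, ?_, ?_⟩
    · rw [Category.assoc, hg, Scheme.SpecMap_stalkSpecializes_fromSpecStalk_assoc]
    · have : Spec.preimage (Spec.map (C.presheaf.stalkSpecializes hsp) ≫ g) =
          Spec.preimage g ≫ C.presheaf.stalkSpecializes hsp := by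
        apply Spec.map_injective; simp
      rw [this]; rfl
  choose a ha using key
  refine ⟨_, ⟨_, ha, rfl⟩, finsum_nonneg fun p => ?_⟩
  by_cases hp : Order.coheight p = 1
  swap
  · simp [hp]
  by_cases h0 : algebraMap (C.presheaf.stalk p) C.functionField (a p) = 0
  · simp [h0]
  rw [Scheme.le_ord_iff hp h0]
  have : Ring.KrullDimLE 1 (C.presheaf.stalk p) := krullDimLE_of_coheight_le hp.le
  exact Ring.ordFrac_ge_one_of_ne_zero (fun h => h0 (by rw [h, map_zero]))

end Toric

/-! ### Lattice bases and unimodular cones -/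

section LatticeBasis

variable {V : Type} [AddCommGroup V] [Module ℝ V] {ι : Type*}

/-- The basis `c` of the real vector space is a `ℤ`-basis of the lattice `N`. -/
def IsLatticeBasis (N : AddSubgroup V) (c : Basis ι ℝ V) : Prop :=
  ∀ x, x ∈ N ↔ ∀ i, ∃ z : ℤ, c.repr x i = z

theorem IsLatticeBasis.self_mem {N : AddSubgroup V} {c : Basis ι ℝ V} (hc : IsLatticeBasis N c)
    (i : ι) : c i ∈ N := by
  classical
  refine (hc _).2 fun j => ⟨if i = j then 1 else 0, ?_⟩
  rw [c.repr_self, Finsupp.single_apply]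
  split_ifs <;> simp

theorem IsLatticeBasis.coord_mem {N : AddSubgroup V} {c : Basis ι ℝ V} (hc : IsLatticeBasis N c)
    (i : ι) : c.coord i ∈ dualLattice N := fun x hx => (hc x).1 hx i

/-- A lattice is its own double dual. -/
theorem IsLatticeBasis.mem_of_dual {N : AddSubgroup V} {c : Basis ι ℝ V} (hc : IsLatticeBasis N c)
    {x : V} (hx : ∀ u ∈ dualLattice N, ∃ z : ℤ, u x = z) : x ∈ N :=
  (hc x).2 fun i => hx _ (hc.coord_mem i)

theorem coord_self [DecidableEq ι] (c : Basis ι ℝ V) (i j : ι) :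
    c.coord i (c j) = if i = j then 1 else 0 := by
  rw [c.coord_apply, c.repr_self, Finsupp.single_apply]
  simp only [eq_comm]

theorem apply_eq_sum [Fintype ι] (c : Basis ι ℝ V) (u : Dual ℝ V) (x : V) :
    u x = ∑ i, c.coord i x * u (c i) := by
  conv_lhs => rw [← c.sum_repr x]
  simp only [map_sum, map_smul, smul_eq_mul, Basis.coord_apply]

theorem intCast_smul_dual (z : ℤ) (u : Dual ℝ V) : (z : ℝ) • u = z • u := by
  ext x
  simp

theorem eq_sum_coord [Fintype ι] (c : Basis ι ℝ V) (u : Dual ℝ V) :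
    u = ∑ i, u (c i) • c.coord i := by
  ext x
  rw [LinearMap.sum_apply, apply_eq_sum c u x]
  exact Finset.sum_congr rfl fun i _ => mul_comm _ _

/-- The cone in the dual space of `V` whose lineality space is spanned by the coordinates `c_i^*`,
`i ∈ I`, and which is generated by this space and the `c_j^*`, `j ∈ J`; it is encoded by the
inequalities and equations that define it. The coordinates with index in `I` are free, even when the
index also lies in `J`. -/
def coordCone (c : Basis ι ℝ V) (I J : Set ι) : PointedCone ℝ (Dual ℝ V) where
  carrier := {u | (∀ k, k ∉ I → 0 ≤ u (c k)) ∧ ∀ k, k ∉ I → k ∉ J → u (c k) = 0}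
  zero_mem' := by simp
  add_mem' := by
    rintro a b ⟨h1, h2⟩ ⟨h3, h4⟩
    refine ⟨fun k hk => add_nonneg (h1 k hk) (h3 k hk), fun k hk hk' => ?_⟩
    simp [h2 k hk hk', h4 k hk hk']
  smul_mem' := by
    rintro ⟨r, hr⟩ u ⟨h1, h2⟩
    refine ⟨fun k hk => mul_nonneg hr (h1 k hk), fun k hk hk' => ?_⟩
    change r * u (c k) = 0
    rw [h2 k hk hk', mul_zero]

theorem coord_mem_coordCone (c : Basis ι ℝ V) {I J : Set ι} {i : ι} (hi : i ∈ I ∨ i ∈ J) :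
    c.coord i ∈ coordCone c I J := by
  classical
  refine ⟨fun k _ => ?_, fun k hk hk' => ?_⟩
  · rw [coord_self]; split_ifs <;> simp
  · rw [coord_self, if_neg]
    rintro rfl
    exact hi.elim hk hk'

theorem neg_coord_mem_coordCone (c : Basis ι ℝ V) {I J : Set ι} {i : ι} (hi : i ∈ I) :
    -c.coord i ∈ coordCone c I J := by
  classical
  have h : ∀ k, k ∉ I → (-c.coord i) (c k) = 0 := fun k hk => by
    rw [LinearMap.neg_apply, coord_self, if_neg (by rintro rfl; exact hk hi), neg_zero]
  exact ⟨fun k hk => (h k hk).ge, fun k hk _ => h k hk⟩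

theorem coordCone_le [Fintype ι] {c : Basis ι ℝ V} {I J : Set ι} {σ : PointedCone ℝ (Dual ℝ V)}
    (h1 : ∀ i ∈ I, c.coord i ∈ σ) (h2 : ∀ i ∈ I, -c.coord i ∈ σ) (h3 : ∀ j ∈ J, c.coord j ∈ σ) :
    coordCone c I J ≤ σ := by
  intro u hu
  rw [eq_sum_coord c u]
  refine sum_mem fun k _ => ?_
  by_cases hI : k ∈ I
  · rcases le_total 0 (u (c k)) with h | h
    · exact σ.smul_mem h (h1 k hI)
    · have := σ.smul_mem (neg_nonneg.2 h) (h2 k hI)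
      rwa [neg_smul_neg] at this
  by_cases hJ : k ∈ J
  · exact σ.smul_mem (hu.1 k hI) (h3 k hJ)
  · rw [hu.2 k hI hJ, zero_smul]; exact zero_mem _

theorem hull_eq_coordCone [Fintype ι] (c : Basis ι ℝ V) (I J : Set ι) :
    PointedCone.hull ℝ (c.coord '' I ∪ (fun i => -c.coord i) '' I ∪ c.coord '' J) =
      coordCone c I J := by
  apply le_antisymm
  · refine Submodule.span_le.2 ?_
    rintro _ ((⟨i, hi, rfl⟩ | ⟨i, hi, rfl⟩) | ⟨j, hj, rfl⟩)
    · exact coord_mem_coordCone c (Or.inl hi)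
    · exact neg_coord_mem_coordCone c hi
    · exact coord_mem_coordCone c (Or.inr hj)
  · refine coordCone_le (fun i hi => ?_) (fun i hi => ?_) (fun i hi => ?_) <;>
      apply PointedCone.subset_hull
    · exact Or.inl (Or.inl ⟨i, hi, rfl⟩)
    · exact Or.inl (Or.inr ⟨i, hi, rfl⟩)
    · exact Or.inr ⟨i, hi, rfl⟩

/-- The integral dual basis of a lattice basis. -/
noncomputable def IsLatticeBasis.dualBasisInt [Fintype ι] {N : AddSubgroup V} {c : Basis ι ℝ V}
    (hc : IsLatticeBasis N c) : Basis ι ℤ (dualLattice N) :=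
  Basis.ofEquivFun
    { toFun := fun u i => (u.2 _ (hc.self_mem i)).choose
      map_add' := by
        intro u w
        ext i
        have h1 := (u.2 _ (hc.self_mem i)).choose_spec
        have h2 := (w.2 _ (hc.self_mem i)).choose_spec
        have h3 := ((u + w).2 _ (hc.self_mem i)).choose_spec
        have : ((u + w : dualLattice N) : Dual ℝ V) (c i) = u.1 (c i) + w.1 (c i) := rfl
        simp only [Pi.add_apply]
        exact_mod_cast h3.symm.trans (this.trans (congrArg₂ (· + ·) h1 h2))
      map_smul' := by
        intro r u
        ext i
        have h1 := (u.2 _ (hc.self_mem i)).choose_spec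
        have h3 := ((r • u).2 _ (hc.self_mem i)).choose_spec
        have : ((r • u : dualLattice N) : Dual ℝ V) (c i) = r * u.1 (c i) := by
          simp
        simp only [Pi.smul_apply, smul_eq_mul, RingHom.id_apply]
        exact_mod_cast h3.symm.trans (this.trans (congrArg ((r : ℝ) * ·) h1))
      invFun := fun a => ⟨∑ i, (a i : ℝ) • c.coord i, sum_mem fun i _ => by
        rw [intCast_smul_dual]
        exact zsmul_mem (hc.coord_mem i) _⟩
      left_inv := by
        intro u
        apply Subtype.ext
        conv_rhs => rw [eq_sum_coord c u.1]
        refine Finset.sum_congr rfl fun i _ => ?_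
        rw [(u.2 _ (hc.self_mem i)).choose_spec]
      right_inv := by
        classical
        intro a
        ext i
        have h : ∀ (h : ∃ z : ℤ, (∑ i, (a i : ℝ) • c.coord i) (c i) = z), h.choose = a i := by
          intro h
          have h1 := h.choose_spec
          generalize h.choose = z at h1 ⊢
          simp only [LinearMap.sum_apply, LinearMap.smul_apply, coord_self, smul_eq_mul,
            mul_ite, mul_one, mul_zero, Finset.sum_ite_eq', Finset.mem_univ, if_true] at h1
          exact_mod_cast h1.symm
        exact h _ }

theorem IsLatticeBasis.finrank_dualLattice [Fintype ι] {N : AddSubgroup V} {c : Basis ι ℝ V}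
    (hc : IsLatticeBasis N c) : finrank ℤ (dualLattice N) = finrank ℝ V := by
  rw [finrank_eq_card_basis hc.dualBasisInt, finrank_eq_card_basis c]

/-- Every `ℤ`-basis of the dual lattice consists of the coordinates of a basis of the lattice. -/
theorem IsLatticeBasis.exists_coord_eq [Fintype ι] {N : AddSubgroup V} {c : Basis ι ℝ V}
    (hc : IsLatticeBasis N c) {κ : Type*} [Fintype κ] (b : Basis κ ℤ (dualLattice N)) :
    ∃ d : Basis κ ℝ V, IsLatticeBasis N d ∧ ∀ i, d.coord i = b i := by
  classical
  have : FiniteDimensional ℝ V := c.finiteDimensional_of_finite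
  -- an element of the dual lattice is an integral combination of the `b i`
  have hint : ∀ u : dualLattice N, (u : Dual ℝ V) = ∑ i, (b.repr u i : ℝ) • (b i : Dual ℝ V) := by
    intro u
    have h := congrArg (dualLattice N).subtype (b.sum_repr u)
    rw [map_sum] at h
    refine h.symm.trans (Finset.sum_congr rfl fun i _ => ?_)
    rw [intCast_smul_dual]
    exact map_zsmul (dualLattice N).subtype _ _
  have hspan : ⊤ ≤ Submodule.span ℝ (Set.range fun i => (b i : Dual ℝ V)) := by
    intro u _
    rw [eq_sum_coord c u]
    refine sum_mem fun i _ => Submodule.smul_mem _ _ ?_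
    have h := hint ⟨_, hc.coord_mem i⟩
    simp only at h
    rw [h]
    exact sum_mem fun j _ => Submodule.smul_mem _ _ (Submodule.subset_span ⟨j, rfl⟩)
  have hcard : Fintype.card κ = finrank ℝ (Dual ℝ V) := by
    rw [Subspace.dual_finrank_eq, ← hc.finrank_dualLattice, finrank_eq_card_basis b]
  let B : Basis κ ℝ (Dual ℝ V) := basisOfTopLeSpanOfCardEqFinrank _ hspan hcard
  have hB : ∀ i, B i = b i := fun i => by simp [B]
  let d : Basis κ ℝ V := B.dualBasis.map (evalEquiv ℝ V).symm
  have hBd : ∀ i j, B i (d j) = if i = j then 1 else 0 := by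
    intro i j
    have : B i (d j) = B.dualBasis j (B i) := by
      simp only [d, Basis.map_apply]
      rw [apply_evalEquiv_symm_apply]
    rw [this, Basis.dualBasis_apply_self]
  have hcoord : ∀ i, d.coord i = b i := by
    intro i
    rw [← hB]
    refine d.ext fun j => ?_
    rw [hBd, coord_self]
  refine ⟨d, fun x => ⟨fun hx i => ?_, fun hx => hc.mem_of_dual fun u hu => ?_⟩, hcoord⟩
  · rw [← d.coord_apply, hcoord]
    exact (b i).2 x hx
  · choose a ha using hx
    refine ⟨∑ i, b.repr ⟨u, hu⟩ i * a i, ?_⟩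
    have h := LinearMap.congr_fun (hint ⟨u, hu⟩) x
    refine h.trans ?_
    simp [← hcoord, ha]

/-- A unimodular cone of the dual lattice is defined by inequalities and equations given by a basis
of the lattice. -/
theorem IsUnimodularCone.exists_eq_coordCone {N : AddSubgroup V}
    (hN : ∃ c : Basis (Fin (finrank ℝ V)) ℝ V, IsLatticeBasis N c)
    {σ : PointedCone ℝ (Dual ℝ V)} (hσ : IsUnimodularCone (dualLattice N) σ) :
    ∃ (c : Basis (Fin (finrank ℝ V)) ℝ V) (I J : Set (Fin (finrank ℝ V))),
      IsLatticeBasis N c ∧ Disjoint I J ∧ σ = coordCone c I J := by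
  obtain ⟨c, hc⟩ := hN
  have hr := hc.finrank_dualLattice
  unfold IsUnimodularCone at hσ
  rw [hr] at hσ
  obtain ⟨b, I, J, hIJ, rfl⟩ := hσ
  obtain ⟨d, hd, hdb⟩ := hc.exists_coord_eq b
  refine ⟨d, I, J, hd, hIJ, ?_⟩
  rw [← hull_eq_coordCone]
  simp only [hdb]

theorem exists_isLatticeBasis {V : Type} [NormedAddCommGroup V] [NormedSpace ℝ V]
    [FiniteDimensional ℝ V] (N : Submodule ℤ V) [DiscreteTopology N] [IsZLattice ℝ N] :
    ∃ c : Basis (Fin (finrank ℝ V)) ℝ V, IsLatticeBasis N.toAddSubgroup c := by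
  have := ZLattice.module_free ℝ N
  have := ZLattice.module_finite ℝ N
  let b : Basis (Fin (finrank ℝ V)) ℤ N := finBasisOfFinrankEq ℤ N (ZLattice.rank ℝ N)
  refine ⟨b.ofZLatticeBasis ℝ N, fun x => ⟨fun hx i => ⟨b.repr ⟨x, hx⟩ i, ?_⟩, fun hx => ?_⟩⟩
  · exact b.ofZLatticeBasis_repr_apply ℝ N ⟨x, hx⟩ i
  · choose a ha using hx
    rw [← (b.ofZLatticeBasis ℝ N).sum_repr x]
    refine sum_mem fun i _ => ?_
    rw [ha, b.ofZLatticeBasis_apply ℝ N, Int.cast_smul_eq_zsmul ℝ]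
    exact zsmul_mem (b i).2 _

end LatticeBasis

/-! ### Faces of unimodular cones -/

section Faces

variable {V : Type} [AddCommGroup V] [Module ℝ V] {ι : Type*}

theorem coordCone_mono (c : Basis ι ℝ V) (I : Set ι) {J K : Set ι} (h : K ⊆ J) :
    coordCone c I K ≤ coordCone c I J :=
  fun _ hu => ⟨hu.1, fun k hI hJ => hu.2 k hI fun hK => hJ (h hK)⟩

theorem coordCone_isFaceOf (c : Basis ι ℝ V) (I : Set ι) {J K : Set ι} (h : K ⊆ J) :
    (coordCone c I K).IsFaceOf (coordCone c I J) := by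
  refine ⟨coordCone_mono c I h, fun {x y a} hx hy ha hxy => ⟨hx.1, fun k hI hK => ?_⟩⟩
  have h0 : a * x (c k) + y (c k) = 0 := hxy.2 k hI hK
  have h1 := hx.1 k hI
  have h2 := hy.1 k hI
  have h3 : a * x (c k) = 0 := le_antisymm (by linarith) (mul_nonneg ha.le h1)
  exact (mul_eq_zero.1 h3).resolve_left ha.ne'

/-- A face of `coordCone c I J` is generated by the lineality space and the `c_j^*` it contains. -/
theorem eq_coordCone_of_isFaceOf [Fintype ι] {c : Basis ι ℝ V} {I J : Set ι}
    {F : PointedCone ℝ (Dual ℝ V)} (hF : F.IsFaceOf (coordCone c I J)) :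
    F = coordCone c I {j ∈ J | c.coord j ∈ F} := by
  classical
  apply le_antisymm
  · intro u hu
    have hu' := hF.le hu
    refine ⟨hu'.1, fun k hI hk => ?_⟩
    by_cases hJ : k ∈ J
    · have hkF : c.coord k ∉ F := fun h => hk ⟨hJ, h⟩
      by_contra hne
      have hpos : 0 < u (c k) := lt_of_le_of_ne (hu'.1 k hI) (Ne.symm hne)
      refine hkF (hF.mem_of_smul_add_mem (y := u - u (c k) • c.coord k)
        (coord_mem_coordCone c (Or.inr hJ)) ⟨fun l hl => ?_, fun l hl hl' => ?_⟩ hpos ?_)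
      · rw [LinearMap.sub_apply, LinearMap.smul_apply, coord_self]
        split_ifs with hkl
        · subst hkl; simp
        · simpa using hu'.1 l hl
      · rw [LinearMap.sub_apply, LinearMap.smul_apply, coord_self, hu'.2 l hl hl',
          if_neg (by rintro rfl; exact hl' hJ)]
        simp
      · rwa [add_sub_cancel]
    · exact hu'.2 k hI hJ
  · have h0 : ∀ i ∈ I, (1 : ℝ) • c.coord i + -c.coord i ∈ F := fun i _ => by simp
    refine coordCone_le (fun i hi => ?_) (fun i hi => ?_) fun j hj => hj.2
    · exact hF.mem_of_smul_add_mem (coord_mem_coordCone c (Or.inl hi))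
        (neg_coord_mem_coordCone c hi) one_pos (h0 i hi)
    · refine hF.mem_of_smul_add_mem (neg_coord_mem_coordCone c hi)
        (coord_mem_coordCone c (Or.inl hi)) one_pos ?_
      rw [one_smul, neg_add_cancel]; exact zero_mem _

/-- A point of the relative interior of `coordCone c I J`. -/
theorem exists_mem_coordCone_one [Fintype ι] (c : Basis ι ℝ V) (I J : Set ι) :
    ∃ u ∈ coordCone c I J, ∀ j ∈ J, u (c j) = 1 := by
  classical
  refine ⟨∑ j ∈ Finset.univ.filter (· ∈ J), c.coord j, sum_mem fun j hj =>
    coord_mem_coordCone c (Or.inr (Finset.mem_filter.1 hj).2), fun j hj => ?_⟩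
  simp only [LinearMap.sum_apply, coord_self]
  simp [hj]

/-- A face that contains a point of the relative interior is the whole cone. -/
theorem coordCone_le_of_isFaceOf [Fintype ι] {c : Basis ι ℝ V} {I J : Set ι}
    {F : PointedCone ℝ (Dual ℝ V)} (hF : F.IsFaceOf (coordCone c I J)) {u : Dual ℝ V}
    (huF : u ∈ F) (hu : ∀ j ∈ J, j ∉ I → 0 < u (c j)) : coordCone c I J ≤ F := by
  have h := eq_coordCone_of_isFaceOf hF
  rw [h] at huF ⊢
  refine fun w hw => ⟨hw.1, fun k hI hk => ?_⟩
  by_cases hJ : k ∈ J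
  · exact absurd (huF.2 k hI hk) (hu k hJ hI).ne'
  · exact hw.2 k hI hJ

theorem mem_coneSpan_coordCone [Fintype ι] {c : Basis ι ℝ V} {I J : Set ι} {u : Dual ℝ V} :
    u ∈ coneSpan (coordCone c I J) ↔ ∀ k, k ∉ I → k ∉ J → u (c k) = 0 := by
  constructor
  · intro hu k hI hJ
    induction hu using Submodule.span_induction with
    | mem x hx => exact hx.2 k hI hJ
    | zero => rfl
    | add x y _ _ hx hy => rw [LinearMap.add_apply, hx, hy, add_zero]
    | smul a x _ hx => rw [LinearMap.smul_apply, hx, smul_zero]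
  · intro hu
    rw [eq_sum_coord c u]
    refine sum_mem fun k _ => ?_
    by_cases hk : k ∈ I ∨ k ∈ J
    · exact Submodule.smul_mem _ _ (Submodule.subset_span (coord_mem_coordCone c hk))
    · rw [not_or] at hk
      rw [hu k hk.1 hk.2, zero_smul]; exact zero_mem _

theorem mem_or_mem_of_coneSpan_eq_top [Fintype ι] {c : Basis ι ℝ V} {I J : Set ι}
    (h : coneSpan (coordCone c I J) = ⊤) (k : ι) : k ∈ I ∨ k ∈ J := by
  classical
  by_contra! hk
  have h1 : c.coord k ∈ coneSpan (coordCone c I J) := h ▸ trivial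
  have h2 := mem_coneSpan_coordCone.1 h1 k hk.1 hk.2
  rw [coord_self, if_pos rfl] at h2
  exact one_ne_zero h2

open Filter Topology in
/-- The cones `coordCone c I J` are closed, for the topology of pointwise convergence. -/
theorem mem_coordCone_of_tendsto {c : Basis ι ℝ V} {I J : Set ι} {f : ℕ → Dual ℝ V}
    {u : Dual ℝ V} (hf : ∀ x, Tendsto (fun m => f m x) atTop (𝓝 (u x)))
    (h : ∃ᶠ m in atTop, f m ∈ coordCone c I J) : u ∈ coordCone c I J := by
  refine ⟨fun k hk => ?_, fun k hk hk' => le_antisymm ?_ ?_⟩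
  · exact ge_of_tendsto_of_frequently (hf _) (h.mono fun m hm => hm.1 k hk)
  · exact le_of_tendsto_of_frequently (hf _) (h.mono fun m hm => (hm.2 k hk hk').le)
  · exact ge_of_tendsto_of_frequently (hf _) (h.mono fun m hm => (hm.2 k hk hk').ge)

end Faces

/-! ### Complete unimodular fans -/

section Fan

variable {V : Type} [AddCommGroup V] [Module ℝ V] {N : AddSubgroup V}
  {Δ : Set (PointedCone ℝ (Dual ℝ V))}

theorem IsFan.inf_mem {Λ : AddSubgroup (Dual ℝ V)} (hΔ : IsFan Λ Δ) {σ τ : PointedCone ℝ (Dual ℝ V)}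
    (hσ : σ ∈ Δ) (hτ : τ ∈ Δ) : σ ⊓ τ ∈ Δ :=
  hΔ.face_mem σ hσ _ (hΔ.inter_face σ hσ τ hτ)

theorem IsFan.isFaceOf {Λ : AddSubgroup (Dual ℝ V)} (hΔ : IsFan Λ Δ)
    {σ τ : PointedCone ℝ (Dual ℝ V)} (hσ : σ ∈ Δ) (hτ : τ ∈ Δ) (h : τ ≤ σ) : τ.IsFaceOf σ := by
  have := hΔ.inter_face σ hσ τ hτ
  rwa [inf_eq_right.2 h] at this

/-- A non-empty set of cones of a fan that is closed under intersections has a least element. -/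
theorem IsFan.exists_isLeast {Λ : AddSubgroup (Dual ℝ V)} (hΔ : IsFan Λ Δ)
    {S : Set (PointedCone ℝ (Dual ℝ V))} (hS : S ⊆ Δ) (hne : S.Nonempty)
    (hinf : ∀ σ ∈ S, ∀ τ ∈ S, σ ⊓ τ ∈ S) : ∃ C, IsLeast S C := by
  obtain ⟨C, hC⟩ := (hΔ.finite.subset hS).exists_minimal hne
  exact ⟨C, hC.1, fun τ hτ => (hC.2 (hinf C hC.1 τ hτ) inf_le_left).trans inf_le_right⟩

theorem IsFan.minCone_mem {Λ : AddSubgroup (Dual ℝ V)} (hΔ : IsFan Λ Δ) : minCone Δ ∈ Δ := by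
  obtain ⟨C, hC⟩ := hΔ.exists_isLeast subset_rfl hΔ.nonempty fun σ hσ τ hτ => hΔ.inf_mem hσ hτ
  have : minCone Δ = C := le_antisymm (sInf_le hC.1) (le_sInf hC.2)
  exact this ▸ hC.1

open Filter Topology in
/-- A finite union of unimodular cones is closed; moreover, one of the cones that contain the limit
of a sequence contains infinitely many of its terms. -/
theorem exists_frequently_mem_of_tendsto
    (hN : ∃ c : Basis (Fin (finrank ℝ V)) ℝ V, IsLatticeBasis N c)
    (hfin : Δ.Finite) (huni : ∀ σ ∈ Δ, IsUnimodularCone (dualLattice N) σ)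
    {f : ℕ → Dual ℝ V} {u : Dual ℝ V} (hf : ∀ x, Tendsto (fun m => f m x) atTop (𝓝 (u x)))
    (h : ∀ m, ∃ σ ∈ Δ, f m ∈ σ) : ∃ σ ∈ Δ, u ∈ σ ∧ ∃ᶠ m in atTop, f m ∈ σ := by
  have h' : ∃ σ ∈ Δ, ∃ᶠ m in atTop, f m ∈ σ := by
    by_contra! hcon
    have : ∀ᶠ m in atTop, ∀ σ ∈ Δ, f m ∉ σ :=
      (hfin.eventually_all).2 fun σ hσ => hcon σ hσ
    obtain ⟨m, hm⟩ := this.exists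
    obtain ⟨σ, hσ, hmσ⟩ := h m
    exact hm σ hσ hmσ
  obtain ⟨σ, hσ, hfr⟩ := h'
  refine ⟨σ, hσ, ?_, hfr⟩
  obtain ⟨c, I, J, hc, -, rfl⟩ := IsUnimodularCone.exists_eq_coordCone hN (huni σ hσ)
  exact mem_coordCone_of_tendsto hf hfr

open Filter Topology in
theorem tendsto_floor_mul_div (x : ℝ) :
    Tendsto (fun m : ℕ => (⌊(m : ℝ) * x⌋ : ℝ) / m) atTop (𝓝 x) := by
  rw [tendsto_iff_norm_sub_tendsto_zero]
  refine squeeze_zero' (Eventually.of_forall fun _ => norm_nonneg _) ?_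
    tendsto_one_div_atTop_nhds_zero_nat
  filter_upwards [eventually_gt_atTop 0] with m hm
  have hm' : (0 : ℝ) < m := by exact_mod_cast hm
  have h1 := Int.floor_le ((m : ℝ) * x)
  have h2 := Int.lt_floor_add_one ((m : ℝ) * x)
  rw [div_sub' hm'.ne', norm_div, Real.norm_of_nonneg hm'.le]
  refine div_le_div_of_nonneg_right ?_ hm'.le
  rw [Real.norm_eq_abs, abs_le]
  constructor <;> linarith

open Filter Topology in
/-- If the cones of a unimodular fan cover the lattice, they cover the whole space. -/
theorem IsUnimodularFan.exists_mem (hΔ : IsUnimodularFan (dualLattice N) Δ)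
    (hN : ∃ c : Basis (Fin (finrank ℝ V)) ℝ V, IsLatticeBasis N c)
    (hcov : ∀ u ∈ dualLattice N, ∃ σ ∈ Δ, u ∈ σ) (u : Dual ℝ V) : ∃ σ ∈ Δ, u ∈ σ := by
  obtain ⟨c, hc⟩ := id hN
  -- approximate `u` by rational vectors with denominator `m`
  let g : ℕ → Dual ℝ V := fun m => ∑ i, (⌊(m : ℝ) * u (c i)⌋ : ℝ) • c.coord i
  have hg : ∀ m, g m ∈ dualLattice N := fun m => sum_mem fun i _ => by
    rw [intCast_smul_dual]; exact zsmul_mem (hc.coord_mem i) _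
  let f : ℕ → Dual ℝ V := fun m => ((m : ℝ)⁻¹) • g m
  have hf : ∀ x, Tendsto (fun m => f m x) atTop (𝓝 (u x)) := by
    intro x
    have h1 : ∀ m, f m x = ∑ i, ((⌊(m : ℝ) * u (c i)⌋ : ℝ) / m) * c.coord i x := by
      intro m
      simp only [f, g, LinearMap.smul_apply, LinearMap.sum_apply, smul_eq_mul, Finset.mul_sum]
      refine Finset.sum_congr rfl fun i _ => ?_
      ring
    simp only [h1]
    rw [apply_eq_sum c u x]
    refine tendsto_finsetSum _ fun i _ => ?_
    rw [mul_comm]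
    refine Tendsto.mul_const _ ?_
    exact tendsto_floor_mul_div (u (c i))
  obtain ⟨σ, hσ, hu, -⟩ := exists_frequently_mem_of_tendsto hN hΔ.finite hΔ.unimodular hf
    fun m => by
      obtain ⟨σ, hσ, hm⟩ := hcov _ (hg m)
      exact ⟨σ, hσ, σ.smul_mem (by positivity) hm⟩
  exact ⟨σ, hσ, hu⟩

open Filter Topology in
theorem tendsto_add_smul_inv (u w : Dual ℝ V) (x : V) :
    Tendsto (fun m : ℕ => (u + ((m : ℝ) + 1)⁻¹ • w) x) atTop (𝓝 (u x)) := by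
  have h : Tendsto (fun m : ℕ => ((m : ℝ) + 1)⁻¹) atTop (𝓝 0) := by
    simpa using tendsto_one_div_add_atTop_nhds_zero_nat (𝕜 := ℝ)
  simpa using (h.mul_const (w x)).const_add (u x)

open Filter Topology in
/-- If the cones of a unimodular fan cover the space, so do those of full dimension: move the given
point in a direction that lies in none of the proper subspaces spanned by cones. -/
theorem IsUnimodularFan.exists_mem_full [FiniteDimensional ℝ V]
    (hΔ : IsUnimodularFan (dualLattice N) Δ)
    (hN : ∃ c : Basis (Fin (finrank ℝ V)) ℝ V, IsLatticeBasis N c)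
    (hcov : ∀ u : Dual ℝ V, ∃ σ ∈ Δ, u ∈ σ) (u : Dual ℝ V) :
    ∃ σ ∈ Δ, coneSpan σ = ⊤ ∧ u ∈ σ := by
  obtain ⟨w, hw⟩ : ∃ w : Dual ℝ V, ∀ σ ∈ Δ, coneSpan σ ≠ ⊤ → w ∉ coneSpan σ := by
    by_contra! hcon
    let s : Set (Submodule ℝ (Dual ℝ V)) := coneSpan '' {σ ∈ Δ | coneSpan σ ≠ ⊤}
    have hs : s.Finite := (hΔ.finite.subset (Set.sep_subset _ _)).image _
    refine Subspace.biUnion_ne_univ_of_top_notMem (s := hs.toFinset) (by simp [s]) ?_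
    refine Set.eq_univ_of_forall fun w => ?_
    obtain ⟨σ, hσ, hne, hw⟩ := hcon w
    simp only [Set.mem_iUnion]
    exact ⟨coneSpan σ, hs.mem_toFinset.2 ⟨σ, ⟨hσ, hne⟩, rfl⟩, hw⟩
  obtain ⟨σ, hσ, hu, hfr⟩ := exists_frequently_mem_of_tendsto hN hΔ.finite hΔ.unimodular
    (tendsto_add_smul_inv u w) fun m => hcov _
  refine ⟨σ, hσ, by_contra fun hne => hw σ hσ hne ?_, hu⟩
  obtain ⟨m, hm⟩ := hfr.exists
  have h1 : u ∈ coneSpan σ := Submodule.subset_span hu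
  have h2 : u + ((m : ℝ) + 1)⁻¹ • w ∈ coneSpan σ := Submodule.subset_span hm
  have h3 := (Submodule.add_mem_iff_right _ h1).1 h2
  exact (Submodule.smul_mem_iff _ (by positivity)).1 h3

/-- The full-dimensional cones that contain `v` cover the space modulo `v`. -/
theorem IsUnimodularFan.exists_add_smul_mem
    (hΔ : IsUnimodularFan (dualLattice N) Δ)
    (hN : ∃ c : Basis (Fin (finrank ℝ V)) ℝ V, IsLatticeBasis N c)
    (hcov : ∀ u : Dual ℝ V, ∃ σ ∈ Δ, coneSpan σ = ⊤ ∧ u ∈ σ) (v u : Dual ℝ V) :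
    ∃ σ ∈ Δ, coneSpan σ = ⊤ ∧ v ∈ σ ∧ ∃ t : ℝ, u + t • v ∈ σ := by
  obtain ⟨σ, ⟨hσ, htop⟩, hv, hfr⟩ := exists_frequently_mem_of_tendsto
    (Δ := {σ ∈ Δ | coneSpan σ = ⊤}) hN
    (hΔ.finite.subset (Set.sep_subset _ _)) (fun σ hσ => hΔ.unimodular σ hσ.1)
    (tendsto_add_smul_inv v u) fun m => by
      obtain ⟨σ, h1, h2, h3⟩ := hcov (v + ((m : ℝ) + 1)⁻¹ • u)
      exact ⟨σ, ⟨h1, h2⟩, h3⟩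
  obtain ⟨m, hm⟩ := hfr.exists
  refine ⟨σ, hσ, htop, hv, (m : ℝ) + 1, ?_⟩
  have h := σ.smul_mem (r := (m : ℝ) + 1) (by positivity) hm
  rw [smul_add, smul_smul, mul_inv_cancel₀ (by positivity), one_smul, add_comm] at h
  exact h

/-- Every cone of a complete unimodular fan lies in a full-dimensional one, namely in one that
contains a point of its relative interior. -/
theorem IsUnimodularFan.exists_le_full (hΔ : IsUnimodularFan (dualLattice N) Δ)
    (hN : ∃ c : Basis (Fin (finrank ℝ V)) ℝ V, IsLatticeBasis N c)
    (hcov : ∀ u : Dual ℝ V, ∃ σ ∈ Δ, coneSpan σ = ⊤ ∧ u ∈ σ) {σ : PointedCone ℝ (Dual ℝ V)}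
    (hσ : σ ∈ Δ) : ∃ B ∈ Δ, coneSpan B = ⊤ ∧ σ ≤ B := by
  classical
  obtain ⟨c, I, J, hc, -, rfl⟩ := IsUnimodularCone.exists_eq_coordCone hN (hΔ.unimodular σ hσ)
  obtain ⟨u, hu, hu1⟩ := exists_mem_coordCone_one c I J
  obtain ⟨B, hB, htop, huB⟩ := hcov u
  refine ⟨B, hB, htop, le_trans (coordCone_le_of_isFaceOf (hΔ.inter_face _ hσ _ hB) ⟨hu, huB⟩ ?_)
    inf_le_right⟩
  exact fun j hj _ => (hu1 j hj).symm ▸ one_pos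

open Filter Topology in
/-- Finitely many strict inequalities survive a small perturbation. -/
theorem exists_pos_forall_mul_le {α : Type*} [Finite α] {a b : α → ℝ} (ha : ∀ i, 0 < a i) :
    ∃ ε : ℝ, 0 < ε ∧ ∀ i, ε * b i ≤ a i := by
  have h : ∀ᶠ ε in 𝓝[>] (0 : ℝ), ∀ i, ε * b i ≤ a i := by
    rw [eventually_all]
    intro i
    have h1 : Tendsto (fun ε : ℝ => ε * b i) (𝓝[>] 0) (𝓝 (0 * b i)) :=
      (tendsto_id.mul_const (b i)).mono_left nhdsWithin_le_nhds
    rw [zero_mul] at h1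
    exact (h1.eventually (gt_mem_nhds (ha i))).mono fun ε h => le_of_lt h
  obtain ⟨ε, h1, h2⟩ := (h.and self_mem_nhdsWithin).exists
  exact ⟨ε, h2, h1⟩

/-- A full-dimensional cone is not a proper face of another cone. -/
theorem IsUnimodularFan.maximal_of_coneSpan_eq_top (hΔ : IsUnimodularFan (dualLattice N) Δ)
    (hN : ∃ c : Basis (Fin (finrank ℝ V)) ℝ V, IsLatticeBasis N c)
    {B : PointedCone ℝ (Dual ℝ V)} (hB : B ∈ Δ) (htop : coneSpan B = ⊤) :
    Maximal (fun σ => σ ∈ Δ) B := by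
  classical
  refine ⟨hB, fun σ hσ hle y hy => ?_⟩
  have hface := hΔ.isFaceOf hσ hB hle
  obtain ⟨c, I, J, hc, -, rfl⟩ := IsUnimodularCone.exists_eq_coordCone hN (hΔ.unimodular B hB)
  obtain ⟨ε, hε, h⟩ := exists_pos_forall_mul_le (a := fun _ : Fin (finrank ℝ V) => 1)
    (b := fun j => y (c j)) fun _ => one_pos
  -- an interior point of `B`
  obtain ⟨u, hu, hu1⟩ := exists_mem_coordCone_one c I J
  refine hface.mem_of_smul_add_mem (y := u - ε • y) hy (hle ⟨fun k hk => ?_, fun k hk hk' => ?_⟩) hε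
    (by rwa [add_sub_cancel])
  · have hkJ := (mem_or_mem_of_coneSpan_eq_top htop k).resolve_left hk
    have := h k
    simpa [hu1 k hkJ] using this
  · exact absurd (mem_or_mem_of_coneSpan_eq_top htop k) (by tauto)

/-- The cones that contain `v` have a least element, and `v` lies in its relative interior. -/
theorem IsUnimodularFan.exists_isLeast_mem (hΔ : IsUnimodularFan (dualLattice N) Δ)
    (hN : ∃ c : Basis (Fin (finrank ℝ V)) ℝ V, IsLatticeBasis N c) {v : Dual ℝ V}
    (hv : ∃ σ ∈ Δ, v ∈ σ) : ∃ C, IsLeast {σ | σ ∈ Δ ∧ v ∈ σ} C ∧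
      ∀ u ∈ coneSpan C, ∃ ε : ℝ, 0 < ε ∧ v - ε • u ∈ C := by
  classical
  obtain ⟨C, hC⟩ := hΔ.exists_isLeast (S := {σ | σ ∈ Δ ∧ v ∈ σ}) (fun σ h => h.1) hv
    fun σ hσ τ hτ => ⟨hΔ.inf_mem hσ.1 hτ.1, hσ.2, hτ.2⟩
  refine ⟨C, hC, fun u hu => ?_⟩
  obtain ⟨c, I, J, hc, hIJ, rfl⟩ :=
    IsUnimodularCone.exists_eq_coordCone hN (hΔ.unimodular C hC.1.1)
  have hpos : ∀ j ∈ J, 0 < v (c j) := by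
    intro j hj
    have hjI : j ∉ I := fun h => hIJ.le_bot ⟨h, hj⟩
    refine lt_of_le_of_ne (hC.1.2.1 j hjI) fun h0 => ?_
    -- otherwise `v` lies in the facet of `C` opposite to `c_j^*`
    have hface := coordCone_isFaceOf c I (Set.sdiff_subset : J \ {j} ⊆ J)
    have hle := hC.2 ⟨hΔ.face_mem _ hC.1.1 _ hface, hC.1.2.1, fun k hI hk => by
      by_cases hkj : k = j
      · rw [hkj, h0]
      · exact hC.1.2.2 k hI fun hJ => hk ⟨hJ, hkj⟩⟩
    have h1 := (hle (coord_mem_coordCone c (Or.inr hj))).2 j hjI (by simp)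
    rw [coord_self, if_pos rfl] at h1
    exact one_ne_zero h1
  obtain ⟨ε, hε, h⟩ := exists_pos_forall_mul_le (a := fun j : J => v (c j))
    (b := fun j : J => u (c j)) fun j => hpos j j.2
  have hu' := mem_coneSpan_coordCone.1 hu
  refine ⟨ε, hε, fun k hk => ?_, fun k hk hk' => ?_⟩
  · by_cases hkJ : k ∈ J
    · simpa using h ⟨k, hkJ⟩
    · simp [hC.1.2.2 k hk hkJ, hu' k hk hkJ]
  · simp [hC.1.2.2 k hk hk', hu' k hk hk']

end Fan

/-! ### Completeness of the fan of a proper toric variety -/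

section Completeness

variable {V : Type} [AddCommGroup V] [Module ℝ V] {N : AddSubgroup V}
  {Δ : Set (PointedCone ℝ (Dual ℝ V))}

/-- A vector `x` that is annihilated by `W`, as a linear form on the quotient by `W`. -/
noncomputable def evalQuot (W : Submodule ℝ (Dual ℝ V)) (x : V) (hx : ∀ u ∈ W, u x = 0) :
    Dual ℝ (Dual ℝ V ⧸ W) :=
  W.liftQ (Dual.eval ℝ V x) fun u hu => hx u hu

@[simp]
theorem evalQuot_mkQ {W : Submodule ℝ (Dual ℝ V)} {x : V} (hx : ∀ u ∈ W, u x = 0)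
    (u : Dual ℝ V) : evalQuot W x hx (W.mkQ u) = u x := rfl

/-- An element of `N` that is annihilated by `W` is a character of the stratum with cocharacter
lattice `M ⧸ (M ∩ W)`. -/
theorem evalQuot_mem {W : Submodule ℝ (Dual ℝ V)} {x : V} (hx : ∀ u ∈ W, u x = 0) (hN : x ∈ N) :
    evalQuot W x hx ∈ dualLattice (quotLattice (dualLattice N) W) := by
  rintro _ ⟨u, hu, rfl⟩
  exact hu x hN

theorem map_mkQ_coneSpan (C : PointedCone ℝ (Dual ℝ V)) : C.map (coneSpan C).mkQ = ⊥ := by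
  refine le_antisymm ?_ bot_le
  rintro _ ⟨y, hy, rfl⟩
  exact (Submodule.Quotient.mk_eq_zero _).2 (Submodule.subset_span hy)

/-- The cones of a unimodular fan whose toric variety is proper cover the lattice. -/
theorem IsUnimodularFan.exists_mem_of_isProper {k : Type u} [Field k]
    (hΔ : IsUnimodularFan (dualLattice N) Δ)
    (hN : ∃ c : Basis (Fin (finrank ℝ V)) ℝ V, IsLatticeBasis N c)
    (Z : ToricVariety k (quotLattice (dualLattice N) (coneSpan (minCone Δ)))
      (starFan Δ (minCone Δ))) (hZ : IsProper Z.str) {u : Dual ℝ V} (hu : u ∈ dualLattice N) :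
    ∃ σ ∈ Δ, u ∈ σ := by
  have h0 : ⊥ ∈ starFan Δ (minCone Δ) :=
    ⟨minCone Δ, hΔ.minCone_mem, le_rfl, (map_mkQ_coneSpan _).symm⟩
  obtain ⟨_, ⟨σ, hσ, -, rfl⟩, hm⟩ := Z.exists_charMonoid_nonneg hZ h0
    (u := (coneSpan (minCone Δ)).mkQ u) ⟨u, hu, rfl⟩
  refine ⟨σ, hσ, ?_⟩
  obtain ⟨c, I, J, hc, -, rfl⟩ := IsUnimodularCone.exists_eq_coordCone hN (hΔ.unimodular σ hσ)
  -- the minimal cone lies in the lineality space of `σ`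
  have hle : minCone Δ ≤ coordCone c I ∅ :=
    sInf_le (hΔ.face_mem _ hσ _ (coordCone_isFaceOf c I (Set.empty_subset J)))
  have hker : ∀ k, k ∉ I → ∀ w ∈ coneSpan (minCone Δ), w (c k) = 0 := fun k hk w hw =>
    mem_coneSpan_coordCone.1 (Submodule.span_mono hle hw) k hk (by simp)
  refine ⟨fun k hk => ?_, fun k hk hk' => ?_⟩
  · refine hm (evalQuot _ (c k) (hker k hk)) ⟨evalQuot_mem _ (hc.self_mem k), ?_⟩
    rintro _ ⟨w, hw, rfl⟩
    exact hw.1 k hk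
  · have h1 := hm (evalQuot _ (c k) (hker k hk)) ⟨evalQuot_mem _ (hc.self_mem k), by
      rintro _ ⟨w, hw, rfl⟩
      exact hw.1 k hk⟩
    have h2 := hm (-evalQuot _ (c k) (hker k hk))
      ⟨neg_mem (evalQuot_mem _ (hc.self_mem k)), by
        rintro _ ⟨w, hw, rfl⟩
        exact neg_nonneg.2 (hw.2 k hk hk').le⟩
    exact le_antisymm (neg_nonneg.1 h2) h1

end Completeness

/-! ### The dual vertex of a facet -/

section Facet

variable {V : Type} [NormedAddCommGroup V] [NormedSpace ℝ V] [FiniteDimensional ℝ V]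

/-- A facet of a reflexive polytope spans the space, and is cut out by a vertex of the polar
polytope, which is a lattice point. -/
theorem IsFacet.exists_dual_vertex {N : AddSubgroup V} {P F : Set V} (hP : IsReflexive N P)
    (hF : IsFacet P F) : ∃ v ∈ dualLattice N, v ∈ polarSet P ∧ F = {x ∈ P | v x = -1} ∧
      Submodule.span ℝ F = ⊤ ∧ dualFace P F = {v} := by
  obtain ⟨-, h0, T, hT, hPT⟩ := hP
  obtain ⟨⟨x0, hx0⟩, hexp, hdim⟩ := hF
  obtain ⟨l, hl⟩ := hexp ⟨x0, hx0⟩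
  have hx0' : x0 ∈ P ∧ ∀ y ∈ P, l y ≤ l x0 := by rw [hl] at hx0; exact hx0
  -- every vector has a positive multiple in `P`
  have habs : ∀ w : V, ∃ ε : ℝ, 0 < ε ∧ ε • w ∈ P := by
    intro w
    have h1 : Filter.Tendsto (fun ε : ℝ => ε • w) (nhdsWithin 0 (Set.Ioi 0)) (nhds ((0 : ℝ) • w)) :=
      (Filter.tendsto_id.smul_const w).mono_left nhdsWithin_le_nhds
    rw [zero_smul] at h1
    obtain ⟨ε, h2, h3⟩ := ((h1.eventually (mem_interior_iff_mem_nhds.1 h0)).and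
      self_mem_nhdsWithin).exists
    exact ⟨ε, h3, h2⟩
  have hspanP : Submodule.span ℝ P = ⊤ := by
    refine eq_top_iff.2 fun w _ => ?_
    obtain ⟨ε, hε, hw⟩ := habs w
    exact (Submodule.smul_mem_iff _ hε.ne').1 (Submodule.subset_span hw)
  have hzero : (0 : V) ∈ P := interior_subset h0
  have hpos : 0 < l x0 := by
    refine lt_of_le_of_ne (by simpa using hx0'.2 0 hzero) fun h => ?_
    have hl0 : ∀ w, l w ≤ 0 := by
      intro w
      obtain ⟨ε, hε, hw⟩ := habs w
      have := hx0'.2 _ hw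
      rw [← h, map_smul, smul_eq_mul] at this
      exact nonpos_of_mul_nonpos_right this hε
    have hl1 : ∀ w, l w = 0 := fun w => le_antisymm (hl0 w) (by
      have := hl0 (-w); rw [map_neg] at this; linarith)
    have hFP : F = P := by rw [hl]; ext; simp [hl1]
    have htop : (affineSpan ℝ F).direction = ⊤ := by
      rw [hFP, direction_affineSpan, eq_top_iff, ← hspanP, Submodule.span_le]
      intro w hw
      have := vsub_mem_vectorSpan ℝ hw hzero
      simpa using this
    rw [htop, finrank_top] at hdim
    omega
  let v : Dual ℝ V := -((l x0)⁻¹ • (l : V →ₗ[ℝ] ℝ))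
  have hv : ∀ x, v x = -((l x0)⁻¹ * l x) := fun x => rfl
  have hvP : v ∈ polarSet P := fun x hx => by
    rw [hv, neg_le_neg_iff, inv_mul_le_iff₀ hpos, mul_one]
    exact hx0'.2 x hx
  have hFv : F = {x ∈ P | v x = -1} := by
    rw [hl]
    ext x
    refine and_congr_right fun hx => ?_
    rw [hv, neg_inj, inv_mul_eq_iff_eq_mul₀ hpos.ne', mul_one]
    exact ⟨fun h => le_antisymm (hx0'.2 x hx) (h x0 hx0'.1), fun h y hy => h ▸ hx0'.2 y hy⟩
  have hspan : Submodule.span ℝ F = ⊤ := by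
    have hle : (affineSpan ℝ F).direction ≤ Submodule.span ℝ F := by
      rw [direction_affineSpan, vectorSpan_def, Submodule.span_le]
      rintro _ ⟨x, hx, y, hy, rfl⟩
      exact sub_mem (Submodule.subset_span hx) (Submodule.subset_span hy)
    have hker : (affineSpan ℝ F).direction ≤ LinearMap.ker v := by
      rw [direction_affineSpan, vectorSpan_def, Submodule.span_le]
      rintro _ ⟨x, hx, y, hy, rfl⟩
      rw [hFv] at hx hy
      simp [hx.2, hy.2]
    have hlt : (affineSpan ℝ F).direction < Submodule.span ℝ F := by
      refine lt_of_le_of_ne hle fun h => ?_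
      have h1 : x0 ∈ (affineSpan ℝ F).direction := h ▸ Submodule.subset_span hx0
      have h2 : v x0 = 0 := hker h1
      rw [hFv] at hx0
      rw [hx0.2] at h2
      norm_num at h2
    have := Submodule.finrank_lt_finrank_of_lt hlt
    exact Submodule.eq_top_of_finrank_eq (le_antisymm (Submodule.finrank_le _) (by omega))
  -- a linear form is determined by its values on `F`
  have huniq : ∀ w : Dual ℝ V, (∀ x ∈ F, w x = -1) → w = v := by
    intro w hw
    refine LinearMap.ext_on hspan fun x hx => ?_
    have h := hx
    rw [hFv] at h
    rw [hw x hx, h.2]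
  have hvlat : v ∈ dualLattice N := by
    rw [hPT, Finset.mem_convexHull'] at hvP
    obtain ⟨w, hw0, hw1, hwv⟩ := hvP
    -- write `v` as a convex combination of vertices of the polar; a vertex `t` that occurs in it
    -- takes the value `-1` on `F`, so it equals `v`
    obtain ⟨t, ht, htw⟩ : ∃ t ∈ T, 0 < w t := by
      by_contra! h
      have := Finset.sum_nonpos h
      linarith
    rw [← huniq t fun x hx => ?_]
    · exact hT ht
    -- `v x = -1` is an average of the values `s x ≥ -1`
    have hge : ∀ s ∈ T, -1 ≤ s x := fun s hs => by
      have : s ∈ polarSet P := hPT ▸ subset_convexHull ℝ _ hs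
      exact this x (hl ▸ hx : x ∈ {x ∈ P | ∀ y ∈ P, l y ≤ l x}).1
    have hsum : ∑ s ∈ T, w s * (s x + 1) = 0 := by
      have h1 := LinearMap.congr_fun hwv x
      simp only [LinearMap.sum_apply, LinearMap.smul_apply, smul_eq_mul] at h1
      have h2 := hx
      rw [hFv] at h2
      simp only [mul_add, mul_one, Finset.sum_add_distrib, h1, hw1, h2.2]
      norm_num
    have h3 := (Finset.sum_eq_zero_iff_of_nonneg fun s hs =>
      mul_nonneg (hw0 s hs) (by linarith [hge s hs])).1 hsum t ht
    have h4 := (mul_eq_zero.1 h3).resolve_left htw.ne'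
    linarith
  refine ⟨v, hvlat, hvP, hFv, hspan, Set.eq_singleton_iff_unique_mem.2 ⟨⟨hvP, fun x hx => ?_⟩,
    fun w hw => huniq w hw.2⟩⟩
  rw [hFv] at hx
  exact hx.2

end Facet

/-! ### Simplicial tangent cones -/

section TangentCone

variable {V : Type} [AddCommGroup V] [Module ℝ V] {ι : Type*}

/-- If finitely many inequalities `0 ≤ u n`, `n ∈ A`, define the simplicial cone dual to the cone
of the basis `c`, then every `c i` is up to a positive multiple one of the vectors in `A`. -/
theorem exists_mem_multiple [Fintype ι] {c : Basis ι ℝ V} {A : Finset V}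
    (hA : ∀ u : Dual ℝ V, (∀ k, 0 ≤ u (c k)) ↔ ∀ n ∈ A, 0 ≤ u n) (i : ι) :
    ∃ n ∈ A, 0 < c.coord i n ∧ n = c.coord i n • c i := by
  classical
  have hnn : ∀ n ∈ A, ∀ k, 0 ≤ c.coord k n := fun n hn k => (hA _).1 (fun l => by
    rw [coord_self]; split_ifs <;> norm_num) n hn
  by_contra! hcon
  let w : Dual ℝ V := ∑ k ∈ Finset.univ.erase i, c.coord k
  have hwn : ∀ n, w n = ∑ k ∈ Finset.univ.erase i, c.coord k n := fun n => by simp [w]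
  have hw0 : ∀ n ∈ A, 0 ≤ w n := fun n hn => by
    rw [hwn]; exact Finset.sum_nonneg fun k _ => hnn n hn k
  obtain ⟨ε, hε, h⟩ := exists_pos_forall_mul_le (α := {n : A // 0 < w n}) (a := fun n => w n.1)
    (b := fun n => c.coord i n.1) fun n => n.2
  -- otherwise `w` could be moved out of the cone through its facet opposite to `c_i^*`
  have hmem : ∀ n ∈ A, 0 ≤ (w - ε • c.coord i) n := by
    intro n hn
    rw [LinearMap.sub_apply, LinearMap.smul_apply, smul_eq_mul]
    rcases (hw0 n hn).lt_or_eq with h1 | h1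
    · exact sub_nonneg.2 (h ⟨⟨n, hn⟩, h1⟩)
    · have h2 : ∀ k, k ≠ i → c.coord k n = 0 := by
        rw [hwn] at h1
        intro k hk
        exact (Finset.sum_eq_zero_iff_of_nonneg fun k _ => hnn n hn k).1 h1.symm k
          (Finset.mem_erase.2 ⟨hk, Finset.mem_univ _⟩)
      have h3 : n = c.coord i n • c i := by
        conv_lhs => rw [← c.sum_repr n]
        refine Finset.sum_eq_single i (fun k _ hk => ?_) (by simp)
        rw [← c.coord_apply, h2 k hk, zero_smul]
      have h4 : c.coord i n = 0 := by
        by_contra hne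
        exact hcon n hn (lt_of_le_of_ne (hnn n hn i) (Ne.symm hne)) h3
      rw [h4, mul_zero, sub_zero]; exact h1.le
  have h5 := (hA _).2 hmem i
  rw [LinearMap.sub_apply, LinearMap.smul_apply, hwn, coord_self, if_pos rfl,
    Finset.sum_eq_zero] at h5
  · simp only [smul_eq_mul, mul_one, zero_sub] at h5
    linarith
  · intro k hk
    rw [coord_self, if_neg (Finset.ne_of_mem_erase hk)]

/-- A pointed and full-dimensional cone `coordCone c I J` is given by the inequalities
`0 ≤ u (c k)`. -/
theorem mem_coordCone_iff_of_pointed {c : Basis ι ℝ V} {I J : Set ι}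
    {A : Finset V} (hA : ∀ u, u ∈ coordCone c I J ↔ ∀ n ∈ A, 0 ≤ u n)
    (hpt : ∀ u, u ∈ coordCone c I J → -u ∈ coordCone c I J → u = 0)
    (hfull : ∃ w : Dual ℝ V, ∀ n ∈ A, 0 < w n) (u : Dual ℝ V) :
    (∀ k, 0 ≤ u (c k)) ↔ ∀ n ∈ A, 0 ≤ u n := by
  classical
  have hI : ∀ i, i ∉ I := by
    intro i hi
    have h := hpt _ (coord_mem_coordCone c (Or.inl hi)) (neg_coord_mem_coordCone c hi)
    have h1 := coord_self c i i
    rw [h, if_pos rfl] at h1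
    exact zero_ne_one h1
  have hJ : ∀ j, j ∈ J := by
    intro j
    by_contra hj
    obtain ⟨w, hw⟩ := hfull
    obtain ⟨ε, hε, h⟩ := exists_pos_forall_mul_le (a := fun n : A => w n)
      (b := fun n : A => c.coord j n) fun n => hw n n.2
    have h1 : w ∈ coordCone c I J := (hA w).2 fun n hn => (hw n hn).le
    have h2 : w - ε • c.coord j ∈ coordCone c I J := (hA _).2 fun n hn => by
      simpa using h ⟨n, hn⟩
    have h3 := h2.2 j (hI j) hj
    rw [LinearMap.sub_apply, h1.2 j (hI j) hj, LinearMap.smul_apply, coord_self, if_pos rfl] at h3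
    simp only [smul_eq_mul, mul_one, zero_sub, neg_eq_zero] at h3
    exact hε.ne' h3
  rw [← hA]
  exact ⟨fun h => ⟨fun k _ => h k, fun k _ hk => absurd (hJ k) hk⟩, fun h k => h.1 k (hI k)⟩

theorem int_eq_one_of_mul_eq_one {a b : ℤ} {x : ℝ} (ha : x = a) (hx : 0 < x)
    (h : x * b = 1) : x = 1 := by
  have h1 : a * b = 1 := by rw [ha] at h; exact_mod_cast h
  have h2 : 0 < a := by rw [ha] at hx; exact_mod_cast hx
  rcases Int.eq_one_or_neg_one_of_mul_eq_one h1 with h3 | h3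
  · rw [ha, h3, Int.cast_one]
  · omega

end TangentCone

/-! ### The local form of a facet -/

section LocalForm

variable {V : Type} [NormedAddCommGroup V] [NormedSpace ℝ V]

/-- The tangent cone at `v` of the intersection of a polar polytope with a full-dimensional cone
`coordCone d I J`, where `v` lies in the relative interior of the face `coordCone d I K`: it is
defined by the vertices of the dual face of `v`, and by the facets of the cone that contain `v`. -/
theorem mem_tangentCone_iff {ι : Type*} [Finite ι] {S : Finset V} {v : Dual ℝ V}
    (hv : v ∈ polarSet (convexHull ℝ (S : Set V))) {d : Basis ι ℝ V} {I J K : Set ι}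
    (hfull : ∀ k, k ∈ I ∨ k ∈ J) (hvK : ∀ k ∈ K, 0 < v (d k))
    (hvK' : ∀ k, k ∉ I → k ∉ K → v (d k) = 0) (u : Dual ℝ V) :
    u ∈ tangentCone (polarSet (convexHull ℝ (S : Set V)) ∩ (coordCone d I J : Set (Dual ℝ V))) v ↔
      (∀ x ∈ S, v x = -1 → 0 ≤ u x) ∧ ∀ k, k ∉ I → k ∉ K → 0 ≤ u (d k) := by
  constructor
  · intro hu
    induction hu using Submodule.span_induction with
    | mem u hu =>
      obtain ⟨y, ⟨hy1, hy2⟩, rfl⟩ := hu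
      refine ⟨fun x hx hvx => ?_, fun k hI hK => ?_⟩
      · have := hy1 x (subset_convexHull ℝ _ hx)
        change 0 ≤ y x - v x
        linarith
      · change 0 ≤ y (d k) - v (d k)
        rw [hvK' k hI hK, sub_zero]
        exact hy2.1 k hI
    | zero => simp
    | add a b _ _ ha hb =>
      exact ⟨fun x hx h => add_nonneg (ha.1 x hx h) (hb.1 x hx h),
        fun k h h' => add_nonneg (ha.2 k h h') (hb.2 k h h')⟩
    | smul r a _ ha =>
      exact ⟨fun x hx h => mul_nonneg r.2 (ha.1 x hx h),
        fun k h h' => mul_nonneg r.2 (ha.2 k h h')⟩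
  · rintro ⟨h1, h2⟩
    have hvS : ∀ x ∈ S, -1 ≤ v x := fun x hx => hv x (subset_convexHull ℝ _ hx)
    -- move from `v` in the direction `u`
    obtain ⟨ε, hε, h⟩ := exists_pos_forall_mul_le (α := K ⊕ {x : S // -1 < v x})
      (a := Sum.elim (fun k => v (d k)) fun x => v x.1 + 1)
      (b := Sum.elim (fun k => -u (d k)) fun x => -u x.1) (by
        rintro (k | x)
        · exact hvK k k.2
        · have := x.2
          simp only [Sum.elim_inr]; linarith)
    have hmem : v + ε • u ∈
        polarSet (convexHull ℝ (S : Set V)) ∩ (coordCone d I J : Set (Dual ℝ V)) := by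
      refine ⟨fun x hx => ?_, fun k hI => ?_, fun k hI hJ => ?_⟩
      · have hconv : Convex ℝ {x : V | -1 ≤ (v + ε • u) x} :=
          convex_halfSpace_ge (v + ε • u).isLinear _
        refine convexHull_min (fun x hx => ?_) hconv hx
        change -1 ≤ v x + ε * u x
        rcases (hvS x hx).lt_or_eq with h3 | h3
        · have := h (Sum.inr ⟨⟨x, hx⟩, h3⟩)
          simp only [Sum.elim_inr] at this
          linarith
        · have := mul_nonneg hε.le (h1 x hx h3.symm)
          linarith
      · change 0 ≤ v (d k) + ε * u (d k)
        by_cases hK : k ∈ K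
        · have := h (Sum.inl ⟨k, hK⟩)
          simp only [Sum.elim_inl] at this
          linarith
        · rw [hvK' k hI hK, zero_add]
          exact mul_nonneg hε.le (h2 k hI hK)
      · exact absurd (hfull k) (by tauto)
    have h3 : (v + ε • u) - v ∈
        tangentCone (polarSet (convexHull ℝ (S : Set V)) ∩ (coordCone d I J : Set (Dual ℝ V))) v :=
      PointedCone.subset_hull ⟨_, hmem, rfl⟩
    have h4 := PointedCone.smul_mem _ (inv_nonneg.2 hε.le) h3
    rwa [add_sub_cancel_left, inv_smul_smul₀ hε.ne'] at h4

variable {N : AddSubgroup V}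

/-- The local form of a facet `F` at a full-dimensional cone `B` of the fan that contains `C`: a
lattice basis `c` that consists of points of `F` (those with index in `X`) and of linear forms that
are non-negative on `B` and define the linear span of `C`. -/
structure IsStarBasis (N : AddSubgroup V) (C B : PointedCone ℝ (Dual ℝ V)) (F : Set V)
    (c : Basis (Fin (finrank ℝ V)) ℝ V) (X : Set (Fin (finrank ℝ V))) : Prop where
  isLatticeBasis : IsLatticeBasis N c
  mem_facet : ∀ i ∈ X, c i ∈ F
  nonneg : ∀ i, i ∉ X → ∀ u ∈ B, 0 ≤ u (c i)
  coord_nonneg : ∀ y ∈ F, ∀ i, 0 ≤ c.coord i y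
  mem_coneSpan_iff : ∀ u, u ∈ coneSpan C ↔ ∀ i, i ∉ X → u (c i) = 0

/-- The basis of `N` dual to the generators of the tangent cone of `P° ∩ B` at `v`, where `P` is the
convex hull of `S`, is a star basis: its members generate the extreme rays of the dual of the
tangent cone, so they are among the vectors that define the tangent cone. -/
theorem exists_isStarBasis (hN : ∃ c : Basis (Fin (finrank ℝ V)) ℝ V, IsLatticeBasis N c)
    {S : Finset V} (hS : (S : Set V) ⊆ N) {v : Dual ℝ V} (hvN : v ∈ dualLattice N)
    (hv : v ∈ polarSet (convexHull ℝ (S : Set V))) {F : Set V}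
    (hF : F = {x ∈ convexHull ℝ (S : Set V) | v x = -1}) (hspan : Submodule.span ℝ F = ⊤)
    {B C : PointedCone ℝ (Dual ℝ V)} (hB : IsUnimodularCone (dualLattice N) B)
    (htop : coneSpan B = ⊤) (hC : C.IsFaceOf B) (hvC : v ∈ C)
    (hvrel : ∀ u ∈ coneSpan C, ∃ ε : ℝ, 0 < ε ∧ v - ε • u ∈ C)
    (hK : IsUnimodularCone (dualLattice N)
      (tangentCone (polarSet (convexHull ℝ (S : Set V)) ∩ (B : Set (Dual ℝ V))) v)) :
    ∃ c X, IsStarBasis N C B F c X := by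
  classical
  obtain ⟨d, I, J, hd, hIJ, rfl⟩ := IsUnimodularCone.exists_eq_coordCone hN hB
  have hfull := mem_or_mem_of_coneSpan_eq_top htop
  obtain ⟨K, hKdef⟩ : ∃ K, K = {j ∈ J | d.coord j ∈ C} := ⟨_, rfl⟩
  have hCK : C = coordCone d I K := hKdef ▸ eq_coordCone_of_isFaceOf hC
  have hKI : ∀ k ∈ K, k ∉ I := fun k hk hI => by
    rw [hKdef] at hk
    exact hIJ.le_bot ⟨hI, hk.1⟩
  subst hCK
  have hvK : ∀ k ∈ K, 0 < v (d k) := by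
    intro k hk
    obtain ⟨ε, hε, h⟩ := hvrel (d.coord k)
      (Submodule.subset_span (coord_mem_coordCone d (Or.inr hk)))
    have := h.1 k (hKI k hk)
    rw [LinearMap.sub_apply, LinearMap.smul_apply, coord_self, if_pos rfl, smul_eq_mul,
      mul_one] at this
    linarith
  have hvK' : ∀ k, k ∉ I → k ∉ K → v (d k) = 0 := hvC.2
  have hKiff := mem_tangentCone_iff hv hfull hvK hvK'
  -- the vectors that define the tangent cone
  let T : Finset (Fin (finrank ℝ V)) := Finset.univ.filter fun k => k ∉ I ∧ k ∉ K
  let A : Finset V := S.filter (fun x => v x = -1) ∪ T.image d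
  have hAiff : ∀ u, u ∈ tangentCone (polarSet (convexHull ℝ (S : Set V)) ∩
      (coordCone d I J : Set (Dual ℝ V))) v ↔ ∀ n ∈ A, 0 ≤ u n := by
    intro u
    rw [hKiff]
    constructor
    · rintro ⟨h1, h2⟩ n hn
      rcases Finset.mem_union.1 hn with hn | hn
      · exact h1 n (Finset.mem_filter.1 hn).1 (Finset.mem_filter.1 hn).2
      · obtain ⟨k, hk, rfl⟩ := Finset.mem_image.1 hn
        exact h2 k (Finset.mem_filter.1 hk).2.1 (Finset.mem_filter.1 hk).2.2
    · refine fun h => ⟨fun x hx hvx => h x ?_, fun k hI hK => h _ ?_⟩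
      · exact Finset.mem_union_left _ (Finset.mem_filter.2 ⟨hx, hvx⟩)
      · exact Finset.mem_union_right _ (Finset.mem_image_of_mem _
          (Finset.mem_filter.2 ⟨Finset.mem_univ _, hI, hK⟩))
  -- the tangent cone lies in the dual of the cone over `F`
  have hFnn : ∀ u : Dual ℝ V, (∀ n ∈ A, 0 ≤ u n) → ∀ x ∈ F, 0 ≤ u x := by
    intro u hu
    have h1 := (hAiff u).2 hu
    intro x hx
    rw [hF] at hx
    clear hu
    induction h1 using Submodule.span_induction with
    | mem u hu =>
      obtain ⟨y, ⟨hy1, -⟩, rfl⟩ := hu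
      have := hy1 x hx.1
      change 0 ≤ y x - v x
      linarith [hx.2]
    | zero => simp
    | add a b _ _ ha hb => exact add_nonneg ha hb
    | smul r a _ ha => exact mul_nonneg r.2 ha
  obtain ⟨c, I', J', hc, -, hcK⟩ := IsUnimodularCone.exists_eq_coordCone hN hK
  rw [hcK] at hAiff
  have hA : ∀ u : Dual ℝ V, (∀ k, 0 ≤ u (c k)) ↔ ∀ n ∈ A, 0 ≤ u n := by
    refine mem_coordCone_iff_of_pointed hAiff (fun u h1 h2 => ?_) ?_
    · refine LinearMap.ext_on hspan fun x hx => ?_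
      have h3 := hFnn u ((hAiff u).1 h1) x hx
      have h4 := hFnn (-u) ((hAiff _).1 h2) x hx
      rw [LinearMap.neg_apply] at h4
      simp only [LinearMap.zero_apply]
      linarith
    · -- `-v` is positive on `F`; add a small interior point of the cone to it
      obtain ⟨w, -, hw⟩ := exists_mem_coordCone_one d I J
      obtain ⟨ε, hε, h⟩ := exists_pos_forall_mul_le (α := S) (a := fun _ => 1 / 2)
        (b := fun x => -w x) fun _ => by norm_num
      refine ⟨ε • w - v, fun n hn => ?_⟩
      change 0 < ε * w n - v n
      rcases Finset.mem_union.1 hn with hn | hn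
      · have := h ⟨n, (Finset.mem_filter.1 hn).1⟩
        have h2 := (Finset.mem_filter.1 hn).2
        simp only at this
        linarith
      · obtain ⟨k, hk, rfl⟩ := Finset.mem_image.1 hn
        have hk := (Finset.mem_filter.1 hk).2
        rw [hvK' k hk.1 hk.2, hw k ((hfull k).resolve_left hk.1)]
        linarith
  have hAN : ∀ n ∈ A, n ∈ N := by
    intro n hn
    rcases Finset.mem_union.1 hn with hn | hn
    · exact hS (Finset.mem_filter.1 hn).1
    · obtain ⟨k, hk, rfl⟩ := Finset.mem_image.1 hn
      exact hd.self_mem k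
  have hcoordA : ∀ i, ∀ n ∈ A, 0 ≤ c.coord i n := fun i => (hA _).1 fun k => by
    rw [coord_self]; split_ifs <;> norm_num
  -- every `c i` is one of the vectors of `A`, as these are primitive
  have hcA : ∀ i, c i ∈ F ∨ ∃ k ∈ T, c i = d k := by
    intro i
    obtain ⟨n, hn, hpos, hni⟩ := exists_mem_multiple hA i
    obtain ⟨a, ha⟩ := (hc n).1 (hAN n hn) i
    have hone : ∀ u ∈ dualLattice N, (u n = 1 ∨ u n = -1) → c i = n := by
      intro u hu h
      obtain ⟨b, hb⟩ := hu _ (hc.self_mem i)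
      have h1 : u n = c.coord i n * u (c i) := by
        conv_lhs => rw [hni]
        rw [map_smul, smul_eq_mul]
      have h2 : c.coord i n = 1 := by
        rcases h with h | h
        · exact int_eq_one_of_mul_eq_one ha hpos (b := b) (by rw [← hb, ← h1, h])
        · refine int_eq_one_of_mul_eq_one ha hpos (b := -b) ?_
          push_cast
          rw [← hb, mul_neg, ← h1, h, neg_neg]
      rw [hni, h2, one_smul]
    rcases Finset.mem_union.1 hn with hn' | hn'
    · have h1 := (Finset.mem_filter.1 hn')
      refine Or.inl ?_
      rw [hone v hvN (Or.inr h1.2), hF]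
      exact ⟨subset_convexHull ℝ _ h1.1, h1.2⟩
    · obtain ⟨k, hk, rfl⟩ := Finset.mem_image.1 hn'
      refine Or.inr ⟨k, hk, hone _ (hd.coord_mem k) (Or.inl ?_)⟩
      rw [coord_self, if_pos rfl]
  have hcF : ∀ i, c i ∉ F → ∃ k, (k ∉ I ∧ k ∉ K) ∧ c i = d k := fun i hi => by
    obtain ⟨k, hk, h⟩ := (hcA i).resolve_left hi
    exact ⟨k, (Finset.mem_filter.1 hk).2, h⟩
  refine ⟨c, {i | c i ∈ F}, hc, fun i hi => hi, fun i hi u hu => ?_, fun y hy i => ?_, fun u => ?_⟩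
  · obtain ⟨k, hk, h⟩ := hcF i hi
    exact h ▸ hu.1 k hk.1
  · exact hFnn _ (hcoordA i) y hy
  · rw [mem_coneSpan_coordCone]
    constructor
    · intro hu i hi
      obtain ⟨k, hk, h⟩ := hcF i hi
      exact h ▸ hu k hk.1 hk.2
    · intro hu k hkI hkK
      have hkA : d k ∈ A := Finset.mem_union_right _ (Finset.mem_image_of_mem _
        (Finset.mem_filter.2 ⟨Finset.mem_univ _, hkI, hkK⟩))
      -- `v` vanishes on `d k`, so that no point of `F` contributes to `d k`
      have h0 : ∑ i, c.coord i (d k) * -v (c i) = 0 := by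
        have h1 := apply_eq_sum c v (d k)
        rw [hvK' k hkI hkK] at h1
        simp only [mul_neg, Finset.sum_neg_distrib]
        rw [← h1, neg_zero]
      have hvc : ∀ i, 0 ≤ -v (c i) := by
        intro i
        by_cases hi : c i ∈ F
        · rw [hF] at hi
          rw [hi.2]; norm_num
        · obtain ⟨l, hl, h⟩ := hcF i hi
          rw [h, hvK' l hl.1 hl.2, neg_zero]
      have h2 := (Finset.sum_eq_zero_iff_of_nonneg fun i _ =>
        mul_nonneg (hcoordA i _ hkA) (hvc i)).1 h0
      rw [apply_eq_sum c u]
      refine Finset.sum_eq_zero fun i hi => ?_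
      by_cases hiF : c i ∈ F
      · have h3 := h2 i hi
        rw [hF] at hiF
        rw [hiF.2, neg_neg, mul_one] at h3
        rw [h3, zero_mul]
      · rw [hu i hiF, mul_zero]

end LocalForm

/-! ### Vertices of a facet -/

section StarBasis

variable {V : Type} [NormedAddCommGroup V] [NormedSpace ℝ V] {N : AddSubgroup V}
  {C B : PointedCone ℝ (Dual ℝ V)} {F : Set V} {c : Basis (Fin (finrank ℝ V)) ℝ V}
  {X : Set (Fin (finrank ℝ V))}

namespace IsStarBasis

/-- The coordinates that belong to the vertices in `F` vanish on the annihilator of `C`. -/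
theorem coord_mem_coneSpan (h : IsStarBasis N C B F c X) {i : Fin (finrank ℝ V)} (hi : i ∈ X) :
    c.coord i ∈ coneSpan C := by
  classical
  refine (h.mem_coneSpan_iff _).2 fun k hk => ?_
  rw [coord_self, if_neg (by rintro rfl; exact hk hi)]

/-- The number of vertices in a star basis is the dimension of `C`. -/
theorem nonempty_equiv (h : IsStarBasis N C B F c X) :
    Nonempty (Fin (finrank ℝ (coneSpan C)) ≃ X) := by
  classical
  have hli : LinearIndependent ℝ fun i : X => c.coord i := by
    have := c.dualBasis.linearIndependent.comp (Subtype.val : X → _) Subtype.val_injective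
    rw [c.coe_dualBasis] at this
    exact this
  have hspan : Submodule.span ℝ (Set.range fun i : X => c.coord i) = coneSpan C := by
    apply le_antisymm
    · rw [Submodule.span_le]
      rintro _ ⟨i, rfl⟩
      exact h.coord_mem_coneSpan i.2
    · intro u hu
      rw [eq_sum_coord c u]
      refine sum_mem fun i _ => ?_
      by_cases hi : i ∈ X
      · exact Submodule.smul_mem _ _ (Submodule.subset_span ⟨⟨i, hi⟩, rfl⟩)
      · rw [(h.mem_coneSpan_iff u).1 hu i hi, zero_smul]; exact zero_mem _
  have hcard := finrank_span_eq_card hli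
  rw [hspan] at hcard
  rw [hcard]
  exact ⟨(Fintype.equivFin X).symm⟩

theorem apply_eq_sum_subtype [Fintype X] (h : IsStarBasis N C B F c X) {u : Dual ℝ V}
    (hu : u ∈ coneSpan C) (y : V) : u y = ∑ i : X, c.coord i y * u (c i) := by
  classical
  have h0 : ∀ i, i ∉ X → c.coord i y * u (c i) = 0 := fun i hi => by
    rw [(h.mem_coneSpan_iff u).1 hu i hi, mul_zero]
  rw [apply_eq_sum c u y, ← Finset.sum_subtype (Finset.univ.filter (· ∈ X)) (by simp)
    fun i => c.coord i y * u (c i)]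
  refine (Finset.sum_subset (Finset.subset_univ _) fun i _ hi => h0 i fun hX => hi ?_).symm
  simpa using hX

/-- The coordinates of a point of `F` that belong to the vertices are barycentric coordinates of its
image modulo the annihilator of `C`. -/
theorem sum_coord_eq_one [Fintype X] (h : IsStarBasis N C B F c X) {v : Dual ℝ V} (hvC : v ∈ C)
    (hvF : ∀ x ∈ F, v x = -1) {y : V} (hy : y ∈ F) : ∑ i : X, c.coord i y = 1 := by
  have h1 := h.apply_eq_sum_subtype (Submodule.subset_span hvC) y
  simp only [hvF _ (h.mem_facet _ (Subtype.prop _)), hvF y hy] at h1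
  rw [← Finset.sum_mul] at h1
  linarith

/-- Over a vertex of the projected simplex, `F` lies in a translate of the cone dual to `B`. -/
theorem apply_le_apply (h : IsStarBasis N C B F c X) {i : Fin (finrank ℝ V)} (hi : i ∈ X) {y : V}
    (hy : y ∈ F) (hyi : ∀ u ∈ coneSpan C, u y = u (c i)) {b : Dual ℝ V} (hb : b ∈ B) :
    b (c i) ≤ b y := by
  classical
  rw [apply_eq_sum c b y, apply_eq_sum c b (c i)]
  refine Finset.sum_le_sum fun k _ => ?_
  by_cases hk : k ∈ X
  · rw [hyi _ (h.coord_mem_coneSpan hk)]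
  · rw [coord_self, if_neg (by rintro rfl; exact hk hi), zero_mul]
    exact mul_nonneg (h.coord_nonneg y hy k) (h.nonneg k hk b hb)

/-- A linear form in `B` attains its minimum over `F` at a vertex of the star basis. -/
theorem exists_apply_le (h : IsStarBasis N C B F c X) {v : Dual ℝ V} (hvC : v ∈ C)
    (hvF : ∀ x ∈ F, v x = -1) {y : V} (hy : y ∈ F) {b : Dual ℝ V} (hb : b ∈ B) :
    ∃ i ∈ X, b (c i) ≤ b y := by
  classical
  by_contra! hcon
  have hsum := h.sum_coord_eq_one hvC hvF hy
  have h1 : ∑ i : X, c.coord i y * b (c i) ≤ b y := by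
    rw [apply_eq_sum c b y, ← Finset.sum_subtype (Finset.univ.filter (· ∈ X)) (by simp)
      fun i => c.coord i y * b (c i)]
    refine Finset.sum_le_sum_of_subset_of_nonneg (Finset.subset_univ _) fun i _ hi => ?_
    exact mul_nonneg (h.coord_nonneg y hy i) (h.nonneg i (fun hX => hi (by simpa using hX)) b hb)
  have h2 : ∑ i : X, c.coord i y * (b (c i) - b y) ≤ 0 := by
    simp only [mul_sub, Finset.sum_sub_distrib, ← Finset.sum_mul, hsum]
    linarith
  have h3 : ∀ i ∈ (Finset.univ : Finset X), 0 ≤ c.coord i y * (b (c i) - b y) := fun i _ =>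
    mul_nonneg (h.coord_nonneg y hy i) (sub_nonneg.2 (hcon i i.2).le)
  have h4 := (Finset.sum_eq_zero_iff_of_nonneg h3).1 (le_antisymm h2 (Finset.sum_nonneg h3))
  have h5 : ∑ i : X, c.coord i y = 0 := Finset.sum_eq_zero fun i hi =>
    (mul_eq_zero.1 (h4 i hi)).resolve_right (sub_pos.2 (hcon i i.2)).ne'
  linarith

/-- Two star bases have the same vertices modulo the annihilator of `C`: these are the vertices of
a simplex, the image of `F`. -/
theorem exists_vertex_eq (h : IsStarBasis N C B F c X) {v : Dual ℝ V} (hvC : v ∈ C)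
    (hvF : ∀ x ∈ F, v x = -1) {B' : PointedCone ℝ (Dual ℝ V)}
    {c' : Basis (Fin (finrank ℝ V)) ℝ V} {X' : Set (Fin (finrank ℝ V))}
    (h' : IsStarBasis N C B' F c' X') {i : Fin (finrank ℝ V)} (hi : i ∈ X) :
    ∃ i' ∈ X', ∀ u ∈ coneSpan C, u (c' i') = u (c i) := by
  classical
  have hsum := h'.sum_coord_eq_one hvC hvF (h.mem_facet i hi)
  have h1 := h'.apply_eq_sum_subtype (h.coord_mem_coneSpan hi) (c i)
  rw [coord_self, if_pos rfl] at h1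
  have hle : ∀ k : X', c.coord i (c' k) ≤ 1 := fun k => by
    rw [← h.sum_coord_eq_one hvC hvF (h'.mem_facet k k.2)]
    exact Finset.single_le_sum (f := fun j : X => c.coord j (c' k))
      (fun j _ => h.coord_nonneg _ (h'.mem_facet k k.2) j) (Finset.mem_univ (⟨i, hi⟩ : X))
  -- an average of numbers at most `1` equals `1`
  have h2 : ∑ k : X', c'.coord k (c i) * (1 - c.coord i (c' k)) = 0 := by
    simp only [mul_sub, mul_one, Finset.sum_sub_distrib, ← h1, hsum, sub_self]
  have h3 := (Finset.sum_eq_zero_iff_of_nonneg fun (k : X') _ =>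
    mul_nonneg (h'.coord_nonneg _ (h.mem_facet i hi) k) (sub_nonneg.2 (hle k))).1 h2
  obtain ⟨k, hk⟩ : ∃ k : X', c'.coord k (c i) ≠ 0 := by
    by_contra! h0
    simp [h0] at hsum
  have hk1 : c.coord i (c' k) = 1 :=
    (sub_eq_zero.1 ((mul_eq_zero.1 (h3 k (Finset.mem_univ _))).resolve_left hk)).symm
  have hk0 : ∀ j : X, (j : Fin (finrank ℝ V)) ≠ i → c.coord j (c' k) = 0 := by
    have h4 := h.sum_coord_eq_one hvC hvF (h'.mem_facet k k.2)
    rw [← Finset.add_sum_erase _ _ (Finset.mem_univ (⟨i, hi⟩ : X)), hk1, add_eq_left] at h4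
    intro j hj
    exact (Finset.sum_eq_zero_iff_of_nonneg fun (j : X) _ =>
      h.coord_nonneg _ (h'.mem_facet k k.2) j).1 h4 j
      (Finset.mem_erase.2 ⟨fun h5 => hj (by rw [h5]), Finset.mem_univ _⟩)
  refine ⟨k, k.2, fun u hu => ?_⟩
  rw [h.apply_eq_sum_subtype hu (c' k), Finset.sum_eq_single (⟨i, hi⟩ : X), hk1, one_mul]
  · intro j _ hj
    rw [hk0 j fun h => hj (Subtype.ext h), zero_mul]
  · exact fun h => absurd (Finset.mem_univ _) h

/-- The vertices of a star basis, in the order given by another star basis: `x j` lies over the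
`j`-th vertex of the simplex which is the image of `F`. A linear form in `B` attains its minimum
over the fibre of `F` above this vertex at `x j`, and its minimum over `F` at one of the `x j`. -/
theorem exists_labelling {r : ℕ} {B₀ : PointedCone ℝ (Dual ℝ V)}
    {c₀ : Basis (Fin (finrank ℝ V)) ℝ V} {X₀ : Set (Fin (finrank ℝ V))}
    (h₀ : IsStarBasis N C B₀ F c₀ X₀) (e : Fin r ≃ X₀)
    (h : IsStarBasis N C B F c X) {v : Dual ℝ V} (hvC : v ∈ C) (hvF : ∀ x ∈ F, v x = -1) :
    ∃ x : Fin r → V, (∀ j, x j ∈ F ∧ x j ∈ N ∧ ∀ u ∈ coneSpan C, u (x j) = u (c₀ (e j))) ∧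
      (∀ y ∈ F, ∀ j, (∀ u ∈ coneSpan C, u y = u (c₀ (e j))) → ∀ b ∈ B, b (x j) ≤ b y) ∧
      ∀ y ∈ F, ∀ b ∈ B, ∃ j, b (x j) ≤ b y := by
  choose i hi hi' using fun j => h₀.exists_vertex_eq hvC hvF h (e j).2
  have hA : ∀ y ∈ F, ∀ j, (∀ u ∈ coneSpan C, u y = u (c₀ (e j))) → ∀ b ∈ B, b (c (i j)) ≤ b y :=
    fun y hy j hyj b hb => h.apply_le_apply (hi j) hy
      (fun u hu => (hyj u hu).trans (hi' j u hu).symm) hb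
  refine ⟨fun j => c (i j), fun j => ⟨h.mem_facet _ (hi j), h.isLatticeBasis.self_mem _, hi' j⟩,
    hA, fun y hy b hb => ?_⟩
  obtain ⟨k, hk, hky⟩ := h.exists_apply_le hvC hvF hy hb
  obtain ⟨k₀, hk₀, hk'⟩ := h.exists_vertex_eq hvC hvF h₀ hk
  refine ⟨e.symm ⟨k₀, hk₀⟩, (hA _ (h.mem_facet k hk) _ (fun u hu => ?_) b hb).trans hky⟩
  rw [Equiv.apply_symm_apply]
  exact (hk' u hu).symm

end IsStarBasis

end StarBasis

/-! ### Rays of the star of a cone -/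

section Rays

variable {V : Type} [AddCommGroup V] [Module ℝ V] {N : AddSubgroup V}
  {Δ : Set (PointedCone ℝ (Dual ℝ V))}

/-- In the star of `C`, the image of a full-dimensional cone is generated by its ray generators. -/
theorem IsUnimodularFan.nonneg_of_rayGenerators (hΔ : IsUnimodularFan (dualLattice N) Δ)
    (hN : ∃ c : Basis (Fin (finrank ℝ V)) ℝ V, IsLatticeBasis N c)
    {B C : PointedCone ℝ (Dual ℝ V)} (hB : B ∈ Δ) (htop : coneSpan B = ⊤) (hC : C ∈ Δ)
    (hCB : C ≤ B) {y : Dual ℝ (Dual ℝ V ⧸ coneSpan C)}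
    (hy : ∀ ρ ∈ rayGenerators (quotLattice (dualLattice N) (coneSpan C)) (starFan Δ C),
      ρ ∈ B.map (coneSpan C).mkQ → 0 ≤ y ρ) {b : Dual ℝ V} (hb : b ∈ B) :
    0 ≤ y ((coneSpan C).mkQ b) := by
  classical
  have hface := hΔ.isFaceOf hB hC hCB
  obtain ⟨d, I, J, hd, hIJ, rfl⟩ := IsUnimodularCone.exists_eq_coordCone hN (hΔ.unimodular B hB)
  have hfull := mem_or_mem_of_coneSpan_eq_top htop
  obtain ⟨K, hKJ, rfl⟩ : ∃ K ⊆ J, C = coordCone d I K :=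
    ⟨_, Set.sep_subset _ _, eq_coordCone_of_isFaceOf hface⟩
  rw [eq_sum_coord d b, map_sum, map_sum]
  refine Finset.sum_nonneg fun k _ => ?_
  rw [map_smul, map_smul, smul_eq_mul]
  by_cases hk : k ∈ I ∨ k ∈ K
  · have h0 : (coneSpan (coordCone d I K)).mkQ (d.coord k) = 0 :=
      (Submodule.Quotient.mk_eq_zero _).2 (Submodule.subset_span (coord_mem_coordCone d hk))
    rw [h0, map_zero, mul_zero]
  rw [not_or] at hk
  have hkJ := (hfull k).resolve_left hk.1
  refine mul_nonneg (hb.1 k hk.1) (hy _ ⟨⟨_, hd.coord_mem k, rfl⟩, fun h0 => ?_, ?_, ?_⟩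
    ⟨_, coord_mem_coordCone d (Or.inr hkJ), rfl⟩)
  · have h1 := mem_coneSpan_coordCone.1 ((Submodule.Quotient.mk_eq_zero _).1 h0) k hk.1 hk.2
    rw [coord_self, if_pos rfl] at h1
    exact one_ne_zero h1
  · -- the ray is the image of the face of `B` generated by `C` and `d_k^*`
    refine ⟨coordCone d I (insert k K), hΔ.face_mem _ hB _ (coordCone_isFaceOf d I
      (Set.insert_subset hkJ hKJ)), coordCone_mono d I (Set.subset_insert k K), ?_⟩
    apply le_antisymm
    · refine Submodule.span_le.2 (Set.singleton_subset_iff.2 ?_)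
      exact ⟨_, coord_mem_coordCone d (Or.inr (Set.mem_insert k K)), rfl⟩
    · rintro _ ⟨w, hw, rfl⟩
      have h1 : (coneSpan (coordCone d I K)).mkQ w =
          w (d k) • (coneSpan (coordCone d I K)).mkQ (d.coord k) := by
        rw [← map_smul]
        refine (Submodule.Quotient.eq _).2 (mem_coneSpan_coordCone.2 fun l hI hK => ?_)
        rw [LinearMap.sub_apply, LinearMap.smul_apply, coord_self]
        split_ifs with h2
        · subst h2; simp
        · rw [hw.2 l hI (by rintro (h3 | h3); exacts [h2 h3.symm, hK h3]), smul_zero, sub_zero]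
      exact h1.symm ▸ PointedCone.smul_mem _ (hw.1 k hk.1) (PointedCone.subset_hull rfl)
  · rintro _ ⟨w, hw, rfl⟩ hmem
    obtain ⟨a, ha⟩ := Submodule.mem_span_singleton.1 hmem
    have h1 : (a : ℝ) • d.coord k - w ∈ coneSpan (coordCone d I K) :=
      (Submodule.Quotient.eq _).1 ha
    have h2 := mem_coneSpan_coordCone.1 h1 k hk.1 hk.2
    rw [LinearMap.sub_apply, LinearMap.smul_apply, coord_self, if_pos rfl, smul_eq_mul, mul_one,
      sub_eq_zero] at h2
    obtain ⟨z, hz⟩ := hw _ (hd.self_mem k)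
    have hz0 : 0 ≤ z := by
      have := a.2
      have h3 : (a : ℝ) = z := h2.trans hz
      exact_mod_cast h3 ▸ this
    refine ⟨z.toNat, ?_⟩
    rw [← ha, ← Nat.cast_smul_eq_nsmul ℝ]
    have h4 : ((z.toNat : ℕ) : ℝ) = a := by
      rw [h2, hz]; exact_mod_cast Int.toNat_of_nonneg hz0
    rw [h4]
    rfl

end Rays

/-! ### Nef divisors on the stratum of a cone -/

section Divisor

variable {V : Type} [AddCommGroup V] [Module ℝ V] {N : AddSubgroup V}
  {Δ : Set (PointedCone ℝ (Dual ℝ V))}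

/-- A family of lattice points `m B`, one for every full-dimensional cone `B` that contains `C`,
such that `m B` is minimal on `B` among all of them, is the Cartier data of a nef divisor on the
stratum of `C`. A point belongs to the polyhedron of sections if and only if it is on each `B` at
least `m B`. -/
theorem IsUnimodularFan.exists_nef_divisor (k : Type u) [Field k]
    (hΔ : IsUnimodularFan (dualLattice N) Δ)
    (hN : ∃ c : Basis (Fin (finrank ℝ V)) ℝ V, IsLatticeBasis N c)
    (hle : ∀ σ ∈ Δ, ∃ B ∈ Δ, coneSpan B = ⊤ ∧ σ ≤ B)
    {C : PointedCone ℝ (Dual ℝ V)} (hC : C ∈ Δ)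
    (m : {B // B ∈ Δ ∧ coneSpan B = ⊤ ∧ C ≤ B} → Dual ℝ (Dual ℝ V ⧸ coneSpan C))
    (hlat : ∀ B, m B ∈ dualLattice (quotLattice (dualLattice N) (coneSpan C)))
    (hmin : ∀ B B', ∀ b ∈ B.1, m B ((coneSpan C).mkQ b) ≤ m B' ((coneSpan C).mkQ b)) :
    ∃ D : ToricDivisor (quotLattice (dualLattice N) (coneSpan C)) (starFan Δ C),
      (∀ ZC : ToricVariety k (quotLattice (dualLattice N) (coneSpan C)) (starFan Δ C),
        ZC.IsNef D) ∧
      ∀ y, y ∈ sectionPolyhedron D ↔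
        ∀ B, ∀ b ∈ B.1, m B ((coneSpan C).mkQ b) ≤ y ((coneSpan C).mkQ b) := by
  -- every cone of the star lies in the image of a full-dimensional cone
  have hstar : ∀ τ ∈ starFan Δ C, ∃ B : {B // B ∈ Δ ∧ coneSpan B = ⊤ ∧ C ≤ B},
      τ ≤ B.1.map (coneSpan C).mkQ := by
    rintro _ ⟨σ, hσ, hCσ, rfl⟩
    obtain ⟨B, hB, htop, hσB⟩ := hle σ hσ
    exact ⟨⟨B, hB, htop, hCσ.trans hσB⟩, Submodule.map_mono hσB⟩
  have hmin' : ∀ B B', ∀ q ∈ B.1.map (coneSpan C).mkQ, m B q ≤ m B' q := by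
    rintro B B' _ ⟨b, hb, rfl⟩
    exact hmin B B' b hb
  choose Bρ hBρ using fun ρ : rayGenerators (quotLattice (dualLattice N) (coneSpan C))
    (starFan Δ C) => hstar _ ρ.2.2.2.1
  have hρmem : ∀ ρ, (ρ : Dual ℝ V ⧸ coneSpan C) ∈ (Bρ ρ).1.map (coneSpan C).mkQ :=
    fun ρ => hBρ ρ (PointedCone.subset_hull rfl)
  choose z hz using fun ρ => hlat (Bρ ρ) _ ρ.2.1
  -- the value at a ray does not depend on the cone `B` that contains the ray
  have hD : ∀ B, ∀ ρ : rayGenerators (quotLattice (dualLattice N) (coneSpan C)) (starFan Δ C),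
      (ρ : Dual ℝ V ⧸ coneSpan C) ∈ B.1.map (coneSpan C).mkQ → m B ρ = z ρ := fun B ρ hρ =>
    (le_antisymm (hmin' B _ ρ hρ) (hmin' _ B ρ (hρmem ρ))).trans (hz ρ)
  choose Bτ hBτ using fun τ : starFan Δ C => hstar τ τ.2
  refine ⟨fun ρ => -z ρ, fun ZC => ZC.isNef_of_charMonoid _ (fun τ => m (Bτ τ))
    (fun τ => ⟨hlat _, fun ρ hρ => ?_⟩) fun σ τ => ⟨sub_mem (hlat _) (hlat _), fun q hq => ?_⟩,
    fun y => ⟨fun hy B b hb => ?_, fun hy ρ => ?_⟩⟩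
  · rw [hD _ ρ (hBτ τ hρ)]
    push_cast
    rw [neg_neg]
  · exact sub_nonneg.2 (hmin' _ _ q (hBτ τ hq))
  · have h := hΔ.nonneg_of_rayGenerators hN (y := y - m B) B.2.1 B.2.2.1 hC B.2.2.2
      (fun ρ hρ hρB => ?_) hb
    · exact sub_nonneg.1 h
    · have h1 := hy ⟨ρ, hρ⟩
      push_cast at h1
      rw [neg_neg, ← hD B ⟨ρ, hρ⟩ hρB] at h1
      exact sub_nonneg.2 h1
  · push_cast
    rw [neg_neg, ← hz]
    obtain ⟨b, hb, hbρ⟩ := hρmem ρ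
    have h := hy _ b hb
    have h2 : (coneSpan C).mkQ b = ρ := hbρ
    rwa [h2] at h

end Divisor

/-! ### The Cayley structure of a facet -/

section Splitting

variable {V : Type} [NormedAddCommGroup V] [NormedSpace ℝ V] [FiniteDimensional ℝ V]
  {N : AddSubgroup V} {C B : PointedCone ℝ (Dual ℝ V)} {F : Set V}
  {c : Basis (Fin (finrank ℝ V)) ℝ V} {X : Set (Fin (finrank ℝ V))}

/-- The coordinates given by the vertices of a star basis, together with the projection along them
to the annihilator of `C`. -/
theorem IsStarBasis.exists_splitting (h : IsStarBasis N C B F c X)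
    (e : Fin (finrank ℝ (coneSpan C)) ≃ X) :
    ∃ φ : V ≃ₗ[ℝ] Dual ℝ (Dual ℝ V ⧸ coneSpan C) × (Fin (finrank ℝ (coneSpan C)) → ℝ),
      (∀ y j, (φ y).2 j = c.coord (e j) y) ∧
      ∀ y u, (φ y).1 ((coneSpan C).mkQ u) = u y - ∑ j, (φ y).2 j * u (c (e j)) := by
  classical
  have hker : ∀ y, ∀ u ∈ coneSpan C, u (y - ∑ j, c.coord (e j) y • c (e j)) = 0 := by
    intro y u hu
    rw [map_sub, map_sum, h.apply_eq_sum_subtype hu y, sub_eq_zero,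
      ← e.sum_comp fun i : X => c.coord i y * u (c i)]
    simp only [map_smul, smul_eq_mul]
  -- subtract the combination of the vertices that has the same image modulo the annihilator of `C`
  let f : V →ₗ[ℝ] Dual ℝ (Dual ℝ V ⧸ coneSpan C) × (Fin (finrank ℝ (coneSpan C)) → ℝ) :=
    { toFun := fun y => (evalQuot (coneSpan C) (y - ∑ j, c.coord (e j) y • c (e j)) (hker y),
        fun j => c.coord (e j) y)
      map_add' := by
        intro a b
        refine Prod.ext (LinearMap.ext fun q => ?_) (funext fun j => map_add _ _ _)
        obtain ⟨u, rfl⟩ := (coneSpan C).mkQ_surjective q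
        simp only [evalQuot_mkQ, Prod.fst_add, LinearMap.add_apply]
        rw [← map_add]
        congr 1
        simp only [map_add, add_smul, Finset.sum_add_distrib]
        abel
      map_smul' := by
        intro r a
        refine Prod.ext (LinearMap.ext fun q => ?_) (funext fun j => map_smul _ _ _)
        obtain ⟨u, rfl⟩ := (coneSpan C).mkQ_surjective q
        simp only [evalQuot_mkQ, Prod.smul_fst, LinearMap.smul_apply, RingHom.id_apply]
        rw [← map_smul]
        congr 1
        simp only [map_smul, smul_sub, Finset.smul_sum, smul_smul, smul_eq_mul] }
  have hf1 : ∀ y u, (f y).1 ((coneSpan C).mkQ u) = u y - ∑ j, c.coord (e j) y * u (c (e j)) := by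
    intro y u
    change u (y - ∑ j, c.coord (e j) y • c (e j)) = _
    simp only [map_sub, map_sum, map_smul, smul_eq_mul]
  have hinj : Function.Injective f := by
    rw [← LinearMap.ker_eq_bot, LinearMap.ker_eq_bot']
    intro y hy
    have h2 : ∀ j, c.coord (e j) y = 0 := fun j => congrFun (congrArg Prod.snd hy) j
    refine c.ext_elem fun i => ?_
    have h3 := hf1 y (c.coord i)
    rw [hy] at h3
    simp only [h2, zero_mul, Finset.sum_const_zero, sub_zero] at h3
    rw [← c.coord_apply, ← h3]
    simp
  have hdim : finrank ℝ V =
      finrank ℝ (Dual ℝ (Dual ℝ V ⧸ coneSpan C) × (Fin (finrank ℝ (coneSpan C)) → ℝ)) := by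
    rw [finrank_prod, Subspace.dual_finrank_eq, finrank_fin_fun,
      Submodule.finrank_quotient_add_finrank, Subspace.dual_finrank_eq]
  exact ⟨f.linearEquivOfInjective hinj hdim, fun y j => rfl, fun y u => hf1 y u⟩

open Classical in
/-- If `F` has a star basis at every full-dimensional cone that contains `C`, and these cones cover
the space modulo `C`, then `F` is of Cayley type for `C`. -/
theorem isCayleyType_of_isStarBasis (k : Type u) [Field k]
    {Δ : Set (PointedCone ℝ (Dual ℝ V))} (hΔ : IsUnimodularFan (dualLattice N) Δ)
    (hN : ∃ c : Basis (Fin (finrank ℝ V)) ℝ V, IsLatticeBasis N c)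
    (hle : ∀ σ ∈ Δ, ∃ B ∈ Δ, coneSpan B = ⊤ ∧ σ ≤ B) (hC : C ∈ Δ)
    {v : Dual ℝ V} (hvC : v ∈ C) (hvF : ∀ x ∈ F, v x = -1) (hconv : Convex ℝ F)
    (hclosed : IsClosed F)
    (hcov : ∀ u, ∃ B ∈ Δ, coneSpan B = ⊤ ∧ C ≤ B ∧ ∃ t : ℝ, u + t • v ∈ B)
    (hstar : ∀ B ∈ Δ, coneSpan B = ⊤ → C ≤ B → ∃ c X, IsStarBasis N C B F c X) :
    IsCayleyType k N Δ C F := by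
  obtain ⟨B₀, hB₀, htop₀, hCB₀⟩ := hle C hC
  obtain ⟨c₀, X₀, h₀⟩ := hstar B₀ hB₀ htop₀ hCB₀
  obtain ⟨e⟩ := h₀.nonempty_equiv
  obtain ⟨φ, hφ2, hφ1⟩ := h₀.exists_splitting e
  choose c X hcX using fun B : {B // B ∈ Δ ∧ coneSpan B = ⊤ ∧ C ≤ B} =>
    hstar B.1 B.2.1 B.2.2.1 B.2.2.2
  choose x hx hxmin hxle using fun B => h₀.exists_labelling e (hcX B) hvC hvF
  have hker : ∀ B j, ∀ u ∈ coneSpan C, u (x B j - c₀ (e j)) = 0 := fun B j u hu => by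
    rw [map_sub, (hx B j).2.2 u hu, sub_self]
  choose D hnef hsec using fun j => hΔ.exists_nef_divisor k hN hle hC
    (fun B => evalQuot (coneSpan C) (x B j - c₀ (e j)) (hker B j))
    (fun B => evalQuot_mem _ (sub_mem (hx B j).2.1 (h₀.isLatticeBasis.self_mem _)))
    (fun B B' b hb => by
      simp only [evalQuot_mkQ, map_sub]
      exact sub_le_sub_right (hxmin B _ (hx B' j).1 j (hx B' j).2.2 b hb) _)
  simp only [evalQuot_mkQ] at hsec
  have hφx : ∀ y j, (∀ u ∈ coneSpan C, u y = u (c₀ (e j))) →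
      (φ y).2 = Pi.single j 1 ∧ ∀ u, (φ y).1 ((coneSpan C).mkQ u) = u (y - c₀ (e j)) := by
    intro y j hy
    have h1 : (φ y).2 = Pi.single j 1 := by
      funext i
      rw [hφ2, hy _ (h₀.coord_mem_coneSpan (e i).2), coord_self, Pi.single_apply]
      simp only [Subtype.coe_inj, e.apply_eq_iff_eq]
    refine ⟨h1, fun u => ?_⟩
    rw [hφ1, h1, map_sub]
    simp [Pi.single_apply]
  have hxP : ∀ B j, (φ (x B j)).1 ∈ sectionPolyhedron (D j) := by
    intro B j
    refine (hsec j _).2 fun B' b hb => ?_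
    rw [(hφx _ j (hx B j).2.2).2, map_sub, map_sub]
    exact sub_le_sub_right (hxmin B' _ (hx B j).1 j (hx B j).2.2 b hb) _
  refine ⟨φ.toAffineEquiv, D, fun y => ?_, fun y hy => ?_, fun ZC j => hnef j ZC, ?_⟩
  · constructor
    · intro hy
      have hint : ∀ j, ∃ z : ℤ, (φ y).2 j = z := fun j => by
        rw [hφ2]; exact h₀.isLatticeBasis.coord_mem _ y hy
      refine ⟨?_, hint⟩
      rintro _ ⟨u, hu, rfl⟩
      choose z hz using hint
      obtain ⟨a, ha⟩ := hu y hy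
      choose b hb using fun j => hu _ (h₀.isLatticeBasis.self_mem (e j))
      refine ⟨a - ∑ j, z j * b j, ?_⟩
      refine (hφ1 y u).trans ?_
      simp [ha, hz, hb]
    · rintro ⟨h1, h2⟩
      refine h₀.isLatticeBasis.mem_of_dual fun u hu => ?_
      choose z hz using h2
      obtain ⟨a, ha⟩ := h1 _ ⟨u, hu, rfl⟩
      choose b hb using fun j => hu _ (h₀.isLatticeBasis.self_mem (e j))
      refine ⟨a + ∑ j, z j * b j, ?_⟩
      have h3 := hφ1 y u
      have h4 : (φ y).1 ((coneSpan C).mkQ u) = a := ha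
      have h5 : ∀ j, (φ y).2 j = z j := hz
      rw [h4, eq_sub_iff_add_eq] at h3
      rw [← h3]
      simp [h5, hb]
  · have hy' : ∀ u ∈ coneSpan C, u y = 0 := fun u hu => by
      have hle : coneSpan C ≤ LinearMap.ker (Dual.eval ℝ V y) := Submodule.span_le.2 hy
      exact hle hu
    have h2 : (φ y).2 = 0 := funext fun j => by
      rw [hφ2]; exact hy' _ (h₀.coord_mem_coneSpan (e j).2)
    refine ⟨fun u => ?_, h2⟩
    refine (hφ1 y u).trans ?_
    simp [h2]
  · change φ '' F = _
    apply subset_antisymm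
    · -- `F` is the convex hull of the vertices `x B j`
      have hfin : (Set.range fun p : {B // B ∈ Δ ∧ coneSpan B = ⊤ ∧ C ≤ B} ×
          Fin (finrank ℝ (coneSpan C)) => x p.1 p.2).Finite := by
        have : Finite {B // B ∈ Δ ∧ coneSpan B = ⊤ ∧ C ≤ B} :=
          (hΔ.finite.subset (Set.sep_subset Δ _)).to_subtype
        exact Set.finite_range _
      have hFhull : F ⊆ convexHull ℝ (Set.range fun p : {B // B ∈ Δ ∧ coneSpan B = ⊤ ∧ C ≤ B} ×
          Fin (finrank ℝ (coneSpan C)) => x p.1 p.2) := by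
        intro y hy
        by_contra hcon
        obtain ⟨f, s, hfs, hs⟩ := geometric_hahn_banach_point_closed (convex_convexHull ℝ _)
          (hfin.isClosed_convexHull (𝕜 := ℝ)) hcon
        obtain ⟨B, hB, htop, hCB, t, hb⟩ := hcov (f : V →ₗ[ℝ] ℝ)
        obtain ⟨j, hj⟩ := hxle ⟨B, hB, htop, hCB⟩ y hy _ hb
        have h1 := hs _ (subset_convexHull ℝ _ ⟨(⟨B, hB, htop, hCB⟩, j), rfl⟩)
        simp only [LinearMap.add_apply, LinearMap.smul_apply, hvF y hy, hvF _ (hx _ j).1,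
          ContinuousLinearMap.coe_coe] at hj
        simp only at h1
        linarith
      rintro _ ⟨y, hy, rfl⟩
      have hcv : Convex ℝ (φ ⁻¹' cayleySum fun j => sectionPolyhedron (D j)) :=
        (convex_convexHull ℝ _).linear_preimage φ.toLinearMap
      refine convexHull_min ?_ hcv (hFhull hy)
      rintro _ ⟨p, rfl⟩
      refine subset_convexHull ℝ _ (Set.mem_iUnion.2 ⟨p.2, _, hxP p.1 p.2, ?_⟩)
      exact Prod.ext rfl (hφx _ p.2 (hx p.1 p.2).2.2).1.symm
    · -- a point that lies over a unit vector and is not in `F` violates one of the inequalities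
      -- that define the polyhedron of sections
      refine convexHull_min ?_ (hconv.linear_image φ.toLinearMap)
      refine Set.iUnion_subset fun j => ?_
      rintro _ ⟨y, hy, rfl⟩
      obtain ⟨w, hw⟩ := φ.surjective (y, Pi.single j 1)
      refine ⟨w, ?_, hw⟩
      have hwu : ∀ u, u w = y ((coneSpan C).mkQ u) + u (c₀ (e j)) := by
        intro u
        have h1 := hφ1 w u
        rw [hw] at h1
        simp only [Pi.single_apply, ite_mul, one_mul, zero_mul, Finset.sum_ite_eq',
          Finset.mem_univ, if_true] at h1
        linarith
      have hvw : v w = -1 := by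
        have hv0 : (coneSpan C).mkQ v = 0 :=
          (Submodule.Quotient.mk_eq_zero _).2 (Submodule.subset_span hvC)
        rw [hwu v, hv0, map_zero, zero_add]
        exact hvF _ (h₀.mem_facet _ (e j).2)
      by_contra hcon
      obtain ⟨f, s, hfs, hs⟩ := geometric_hahn_banach_point_closed hconv hclosed hcon
      obtain ⟨B, hB, htop, hCB, t, hb⟩ := hcov (f : V →ₗ[ℝ] ℝ)
      have h1 := (hsec j y).1 hy ⟨B, hB, htop, hCB⟩ _ hb
      have h2 := hwu ((f : V →ₗ[ℝ] ℝ) + t • v)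
      have h3 := hs _ (hx ⟨B, hB, htop, hCB⟩ j).1
      rw [map_sub] at h1
      have h4 : ((f : V →ₗ[ℝ] ℝ) + t • v) (x ⟨B, hB, htop, hCB⟩ j) ≤
          ((f : V →ₗ[ℝ] ℝ) + t • v) w := by linarith
      simp only [LinearMap.add_apply, LinearMap.smul_apply, hvw, hvF _ (hx _ j).1,
        ContinuousLinearMap.coe_coe] at h4
      linarith

end Splitting
end CayleyFacets

theorem mainTheorem4 {k : Type u} [Field k] [IsAlgClosed k] [CharZero k]
    {V : Type} [NormedAddCommGroup V] [NormedSpace ℝ V] [FiniteDimensional ℝ V]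
    (N : Submodule ℤ V) [DiscreteTopology N] [IsZLattice ℝ N]
    (P : Set V) (hP : CayleyFacets.IsReflexive N.toAddSubgroup P)
    (Δ : Set (PointedCone ℝ (Module.Dual ℝ V)))
    (hcracked : CayleyFacets.IsCracked (CayleyFacets.dualLattice N.toAddSubgroup)
      (CayleyFacets.polarSet P) Δ)
    (Z : CayleyFacets.ToricVariety k
      (CayleyFacets.quotLattice (CayleyFacets.dualLattice N.toAddSubgroup)
        (CayleyFacets.coneSpan (CayleyFacets.minCone Δ)))
      (CayleyFacets.starFan Δ (CayleyFacets.minCone Δ)))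
    (hsmooth : AlgebraicGeometry.Smooth Z.str)
    (hproj : CayleyFacets.IsProjective k Z.str) :
    CayleyFacets.HasCayleyFacets k N.toAddSubgroup P Δ := by
  intro F hF
  have hN := CayleyFacets.exists_isLatticeBasis N
  obtain ⟨hΔ, hcr⟩ := hcracked
  -- the fan is complete
  have hcov := hΔ.exists_mem_full hN
    (hΔ.exists_mem hN fun _ hu => hΔ.exists_mem_of_isProper hN Z hproj.isProper hu)
  obtain ⟨v, hvN, hvP, hFv, hspan, hdual⟩ := hF.exists_dual_vertex hP
  obtain ⟨C, hC, hvrel⟩ := hΔ.exists_isLeast_mem hN (v := v)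
    ((hcov v).imp fun σ h => ⟨h.1, h.2.2⟩)
  refine ⟨v, C, hdual, hC, ?_⟩
  obtain ⟨⟨S, hS, rfl⟩, -, -⟩ := hP
  have hconvF : Convex ℝ F := by
    rw [hFv]
    exact (convex_convexHull ℝ _).inter (convex_hyperplane v.isLinear (-1))
  have hclosedF : IsClosed F := by
    rw [hFv]
    exact (S.finite_toSet.isClosed_convexHull (𝕜 := ℝ)).inter
      (isClosed_eq v.continuous_of_finiteDimensional continuous_const)
  refine CayleyFacets.isCayleyType_of_isStarBasis k hΔ hN
    (fun σ hσ => hΔ.exists_le_full hN hcov hσ) hC.1.1 hC.1.2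
    (fun x hx => by rw [hFv] at hx; exact hx.2) hconvF hclosedF (fun u => ?_)
    fun B hB htop hCB => ?_
  · obtain ⟨B, hB, htop, hvB, ht⟩ := hΔ.exists_add_smul_mem hN hcov v u
    exact ⟨B, hB, htop, hC.2 ⟨hB, hvB⟩, ht⟩
  · exact CayleyFacets.exists_isStarBasis hN hS hvN hvP hFv hspan (hΔ.unimodular B hB) htop
      (hΔ.isFaceOf hB hC.1.1 hCB) hC.1.2 hvrel
      (hcr B (hΔ.maximal_of_coneSpan_eq_top hN hB htop) v ⟨hvP, hCB hC.1.2⟩)
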